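/- Let $\nu>0$, let $\alpha:\{1,2,\dots\}\to[0,\infty)$ be summable and not identically zero, and put $\|\alpha\|_1=\sum_{t\ge1}\alpha(t)$. Let $(\ell_{t,j})_{t,j\ge1}$ be i.i.d. positive random variables, with generic copy $\ell$, such that $\|\alpha\|_1\mathbb{E}[\ell]<1$. Consider the discrete-time marked Hawkes process: for every $t\ge1$, conditionally on $X_1,\dots,X_{t-1}$, the count $Z_t$ is Poisson with mean $\lambda_t=\nu+\sum_{s=1}^{t-1}\alpha(s)X_{t-s}$; the marks $(\ell_{t,j})_{j\ge1}$ are independent of $(X_1,\dots,X_{t-1},Z_t)$; and $X_t=\sum_{j=1}^{Z_t}\ell_{t,j}$. Put $L_t=\sum_{s=1}^tX_s$. Call a pair $(\theta_c,x_c)$ of real numbers critical if (all expectations being finite) $$x_c=\mathbb{E}\big[e^{\theta_c\ell+\|\alpha\|_1\ell(x_c-1)}\big],\qquad \mathbb{E}\big[\|\alpha\|_1\ell\, e^{\theta_c\ell+\|\alpha\|_1\ell(x_c-1)}\big]=1 .$$ (i) If the moment generating function $u\mapsto\mathbb{E}[e^{u\ell}]$ takes arbitrarily large finite values (for example, if it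 is finite everywhere), then a critical pair exists. (ii) If a critical pair $(\theta_c,x_c)$ exists, then it is unique and $\theta_c>0$. Moreover, for every $\theta\le\theta_c$ the equation $x=\mathbb{E}[e^{\theta\ell+\|\alpha\|_1\ell(x-1)}]$ has a minimal real solution $g_L(\theta)$ and, with $\Gamma_L(\theta)=\nu(g_L(\theta)-1)$, the laws $\mathbb{P}(L_t/t\in\cdot)$ satisfy the large deviation principle on $\mathbb{R}$ with speed $t$ and rate function $$I_L(x)=\sup_{\theta\le\theta_c}\{\theta x-\Gamma_L(\theta)\}.$$ That is, $I_L:\mathbb{R}\to[0,\infty]$ is lower semicontinuous and, for every Borel set $A\subseteq\mathbb{R}$, $$-\inf_{x\in A^{\circ}}I_L(x)\le\liminf_{t\to\infty}\frac1t\log\mathbb{P}(L_t/t\in A)\le\limsup_{t\to\infty}\frac1t\log\mathbb{P}(L_t/t\in A)\le-\inf_{x\in\overline A}I_L(x).$$ -/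

import Mathlib

open MeasureTheory ProbabilityTheory Filter

/-- A sequence `P n` of measures on a topological space satisfies the large deviation
principle with speed `a n` and rate function `I` with values in `[0, ∞]`. The logarithm is the
extended one (`log 0 = -∞`), and the infimum over the empty set is `+∞`. -/
structure SatisfiesLDP {E : Type*} [TopologicalSpace E] [MeasurableSpace E]
    (P : ℕ → Measure E) (a : ℕ → ℝ) (I : E → EReal) : Prop where
  rate_nonneg : ∀ x, 0 ≤ I x
  rate_lsc : LowerSemicontinuous I
  speed_nonneg : ∀ n, 0 ≤ a n
  speed_mono : Monotone a
  speed_tendsto : Tendsto a atTop atTop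
  lower : ∀ A : Set E, MeasurableSet A →
    -(⨅ x ∈ interior A, I x) ≤
      liminf (fun n => (((a n)⁻¹ : ℝ) : EReal) * ENNReal.log (P n A)) atTop
  upper : ∀ A : Set E, MeasurableSet A →
    limsup (fun n => (((a n)⁻¹ : ℝ) : EReal) * ENNReal.log (P n A)) atTop ≤
      -(⨅ x ∈ closure A, I x)

namespace MarkedHawkes

variable {Ω : Type*}

/-- `X 0 = 0` and `X t = ∑_{j = 1}^{Z t} ℓ t j` for `t ≥ 1`. -/
def X (Z : ℕ → Ω → ℕ) (ℓ : ℕ → ℕ → Ω → ℝ) (t : ℕ) (ω : Ω) : ℝ :=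
  if t = 0 then 0 else ∑ j ∈ Finset.Icc 1 (Z t ω), ℓ t j ω

/-- The intensity `λ t = ν + ∑_{s = 1}^{t - 1} α s * X (t - s)`. -/
def intensity (ν : ℝ) (α : ℕ → ℝ) (Z : ℕ → Ω → ℕ) (ℓ : ℕ → ℕ → Ω → ℝ) (t : ℕ) (ω : Ω) : ℝ :=
  ν + ∑ s ∈ Finset.Ico 1 t, α s * X Z ℓ (t - s) ω

/-- The total mark `L t = ∑_{s = 1}^{t} X s`. -/
def L (Z : ℕ → Ω → ℕ) (ℓ : ℕ → ℕ → Ω → ℝ) (t : ℕ) (ω : Ω) : ℝ :=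
  ∑ s ∈ Finset.Icc 1 t, X Z ℓ s ω

/-- The `ℓ¹` norm `∑_{t = 1}^∞ α t` of a nonnegative sequence (the value at `0` is not used). -/
noncomputable def norm1 (α : ℕ → ℝ) : ℝ := ∑' t : ℕ, α (t + 1)

/-- The `σ`-algebra generated by `X 1, …, X (t - 1)`. -/
@[reducible] def past (Z : ℕ → Ω → ℕ) (ℓ : ℕ → ℕ → Ω → ℝ) (t : ℕ) : MeasurableSpace Ω :=
  ⨆ s ∈ Finset.Ico 1 t, MeasurableSpace.comap (X Z ℓ s) inferInstance

/-- The `σ`-algebra generated by the marks `ℓ t j`, `j ≥ 1`, of time `t`. -/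
@[reducible] def marksAt (ℓ : ℕ → ℕ → Ω → ℝ) (t : ℕ) : MeasurableSpace Ω :=
  ⨆ j : ℕ, MeasurableSpace.comap (ℓ t (j + 1)) inferInstance

/-- `Z` and `ℓ` are the counts and the marks of a discrete-time marked Hawkes process with
baseline `ν` and exciting function `α`: the marks `ℓ t j`, `t, j ≥ 1`, are i.i.d. positive random
variables; for every `t ≥ 1`, conditionally on `X 1, …, X (t - 1)`, the count `Z t` is Poisson
with mean `intensity ν α Z ℓ t`, and the marks of time `t` are independent of
`X 1, …, X (t - 1), Z t`. -/
structure IsMarkedHawkes [MeasurableSpace Ω] (μ : Measure Ω) (ν : ℝ) (α : ℕ → ℝ)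
    (Z : ℕ → Ω → ℕ) (ℓ : ℕ → ℕ → Ω → ℝ) : Prop where
  measurable_count : ∀ t, 1 ≤ t → Measurable (Z t)
  measurable_mark : ∀ t j, 1 ≤ t → 1 ≤ j → Measurable (ℓ t j)
  mark_pos : ∀ t j, 1 ≤ t → 1 ≤ j → ∀ᵐ ω ∂μ, 0 < ℓ t j ω
  mark_indep : iIndepFun (fun p : ℕ × ℕ => ℓ (p.1 + 1) (p.2 + 1)) μ
  mark_ident : ∀ t j, 1 ≤ t → 1 ≤ j → IdentDistrib (ℓ t j) (ℓ 1 1) μ μ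
  mark_indep_past : ∀ t, 1 ≤ t →
    Indep (marksAt ℓ t) (past Z ℓ t ⊔ MeasurableSpace.comap (Z t) inferInstance) μ
  count_poisson : ∀ t, 1 ≤ t → ∀ k : ℕ,
    μ[Set.indicator {ω | Z t ω = k} (fun _ => (1 : ℝ)) | past Z ℓ t] =ᵐ[μ]
      fun ω => Real.exp (-intensity ν α Z ℓ t ω) * intensity ν α Z ℓ t ω ^ k / (k.factorial : ℝ)

variable [MeasurableSpace Ω]

/-- The real solutions `x` of `x = E[exp (θ ℓ + a ℓ (x - 1))]`, the expectation being finite. -/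
def solutions (μ : Measure Ω) (a : ℝ) (ℓ : Ω → ℝ) (θ : ℝ) : Set ℝ :=
  {x | Integrable (fun ω => Real.exp (θ * ℓ ω + a * ℓ ω * (x - 1))) μ ∧
    x = ∫ ω, Real.exp (θ * ℓ ω + a * ℓ ω * (x - 1)) ∂μ}

/-- The minimal solution `g_L θ`; the theorem states that it is attained for `θ ≤ θ_c`. -/
noncomputable def gL (μ : Measure Ω) (a : ℝ) (ℓ : Ω → ℝ) (θ : ℝ) : ℝ :=
  sInf (solutions μ a ℓ θ)

/-- `Γ_L θ = ν (g_L θ - 1)`. -/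
noncomputable def GammaL (μ : Measure Ω) (ν a : ℝ) (ℓ : Ω → ℝ) (θ : ℝ) : ℝ :=
  ν * (gL μ a ℓ θ - 1)

/-- The tangency equations for `(θ_c, x_c)`: `x_c` solves the fixed point equation at `θ_c`, and
`E[a ℓ exp (θ_c ℓ + a ℓ (x_c - 1))] = 1`. -/
def IsTangency (μ : Measure Ω) (a : ℝ) (ℓ : Ω → ℝ) (θc xc : ℝ) : Prop :=
  xc ∈ solutions μ a ℓ θc ∧
  Integrable (fun ω => a * ℓ ω * Real.exp (θc * ℓ ω + a * ℓ ω * (xc - 1))) μ ∧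
  ∫ ω, a * ℓ ω * Real.exp (θc * ℓ ω + a * ℓ ω * (xc - 1)) ∂μ = 1

/-- `I_L x = sup_{θ ≤ θ_c} (θ x - Γ_L θ)`. -/
noncomputable def rateL (μ : Measure Ω) (ν a : ℝ) (ℓ : Ω → ℝ) (θc : ℝ) (x : ℝ) : EReal :=
  ⨆ θ ∈ Set.Iic θc, ((θ * x - GammaL μ ν a ℓ θ : ℝ) : EReal)

end MarkedHawkes

/-!
Write `a = ‖α‖₁`, `h u = E[exp (u ℓ)]` and `ψ u = u - a (h u - 1)`. The substitution
`u = θ + a (x - 1)` turns the fixed point equation `x = E[exp (θ ℓ + a ℓ (x - 1))]` into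
`x = h u`, `ψ u = θ`, and a critical pair into a point `c` with `a h'(c) = 1`, where
`θ_c = ψ c` and `x_c = h c`. As `h'` is strictly increasing, `c` is unique, and `ψ` is strictly
increasing on `(-∞, c]` and onto `(-∞, θ_c]`; hence `θ_c = ψ c > ψ 0 = 0`, the minimal solution is
`g_L (ψ u) = h u`, and `Γ_L (ψ u) = ν (h u - 1)` (`IsCriticalTilt`, `tiltParam`,
`isLeast_solutions`). If `h` is unbounded on its domain, convexity forces its slope up to `a⁻¹`
(`exists_isCriticalTilt`).

Given the past, `X t` is compound Poisson, so `X t` with coefficient `s` in an exponential moment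
may be replaced by `λ t * (h s - 1)`, which is affine in the earlier `X`
(`IsMarkedHawkes.lintegral_mul_exp_X`). Iterating backwards in time yields the exact formula
`log E[exp (θ L t)] = ν ∑_{k < t} (h (f k) - 1)` with
`f k = θ + ∑_{i < k} α (k - i) (h (f i) - 1)`
(`IsMarkedHawkes.integrable_exp_L_and_integral_eq`). This renewal recursion is monotone and
converges to the `u ≤ c` with `ψ u = θ` (`renewalSeq_le_and_tendsto`), so by Cesàro
`t⁻¹ log E[exp (θ L t)] → Γ_L θ` for every `θ ≤ θ_c`.

The upper bound follows from Chernoff bounds on half-lines and compactness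
(`limsup_log_le_of_mgf`). For the lower bound, `Γ_L' (ψ u) = ν h'(u) / (1 - a h'(u))` runs through
all of `(0, ∞)` as `u` runs through `(-∞, c)`, since `a h'` runs through `(0, 1)`. So every
`x > 0` is exposed at some `θ < θ_c`, where the exponential moment localizes near `x`
(`le_liminf_log_of_exposedAt`), and no information beyond `θ_c` is needed. The point `0` is
reached by small exposed points, and the rate is infinite on the negative half-line.
-/

open scoped Topology

/-! ### Large deviation bounds from exponential moments -/

section LargeDeviations

open scoped ENNReal

lemma le_liminf_log_of_eventually_exp_le {P : ℕ → ℝ≥0∞} {r : ℝ}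
    (h : ∀ᶠ t : ℕ in atTop, ENNReal.ofReal (Real.exp (t * r)) ≤ P t) :
    (r : EReal) ≤
      liminf (fun t : ℕ => (((t : ℝ)⁻¹ : ℝ) : EReal) * ENNReal.log (P t)) atTop := by
  refine le_liminf_of_le (by isBoundedDefault) ?_
  filter_upwards [h, eventually_gt_atTop 0] with t ht ht0
  have h0 : (0 : ℝ) < t := by exact_mod_cast ht0
  have h1 := ENNReal.log_le_log ht
  rw [ENNReal.log_ofReal_of_pos (Real.exp_pos _), Real.log_exp] at h1
  have h2 : ((r : ℝ) : EReal) = (((t : ℝ)⁻¹ : ℝ) : EReal) * ((t * r : ℝ) : EReal) := by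
    rw [← EReal.coe_mul, inv_mul_cancel_left₀ h0.ne']
  rw [h2]
  exact mul_le_mul_of_nonneg_left h1 (by exact_mod_cast (inv_nonneg.2 h0.le))

lemma limsup_log_le_of_eventually_le_exp {P : ℕ → ℝ≥0∞} {r : ℝ}
    (h : ∀ᶠ t : ℕ in atTop, P t ≤ ENNReal.ofReal (Real.exp (t * r))) :
    limsup (fun t : ℕ => (((t : ℝ)⁻¹ : ℝ) : EReal) * ENNReal.log (P t)) atTop ≤ r := by
  refine limsup_le_of_le (by isBoundedDefault) ?_
  filter_upwards [h, eventually_gt_atTop 0] with t ht ht0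
  have h0 : (0 : ℝ) < t := by exact_mod_cast ht0
  have h1 := ENNReal.log_le_log ht
  rw [ENNReal.log_ofReal_of_pos (Real.exp_pos _), Real.log_exp] at h1
  have h2 : ((r : ℝ) : EReal) = (((t : ℝ)⁻¹ : ℝ) : EReal) * ((t * r : ℝ) : EReal) := by
    rw [← EReal.coe_mul, inv_mul_cancel_left₀ h0.ne']
  rw [h2]
  exact mul_le_mul_of_nonneg_left h1 (by exact_mod_cast (inv_nonneg.2 h0.le))

/-- If `Λ t / t → c < r`, then `K * exp (Λ t)` is eventually below `exp (t * r)`. -/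
lemma eventually_const_mul_exp_le {Λ : ℕ → ℝ} {c r K : ℝ}
    (h : Tendsto (fun t : ℕ => (t : ℝ)⁻¹ * Λ t) atTop (𝓝 c)) (hr : c < r) :
    ∀ᶠ t : ℕ in atTop, K * Real.exp (Λ t) ≤ Real.exp (t * r) := by
  have h1 : Tendsto (fun t : ℕ => (t : ℝ)⁻¹ * Λ t + (t : ℝ)⁻¹ * Real.log (max K 1)) atTop
      (𝓝 c) := by
    simpa using h.add (tendsto_inv_atTop_nhds_zero_nat.mul_const (Real.log (max K 1)))
  filter_upwards [h1.eventually_lt_const hr, eventually_gt_atTop 0] with t ht ht0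
  have h0 : (0 : ℝ) < t := by exact_mod_cast ht0
  have hK : (0 : ℝ) < max K 1 := lt_max_of_lt_right one_pos
  calc K * Real.exp (Λ t) ≤ max K 1 * Real.exp (Λ t) := by gcongr; exact le_max_left _ _
    _ = Real.exp (Real.log (max K 1) + Λ t) := by rw [Real.exp_add, Real.exp_log hK]
    _ ≤ Real.exp (t * r) := by
        gcongr
        rw [← mul_add, inv_mul_lt_iff₀ h0] at ht
        linarith

variable {Ω : Type*} [MeasurableSpace Ω] {μ : Measure Ω} [IsProbabilityMeasure μ]
  {S : ℕ → Ω → ℝ} {Λ : ℕ → ℝ → ℝ} {Γ : ℝ → ℝ} {θc : ℝ}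

/-- Chernoff's bound on the half-line `{y | m < θ * y - Γ θ}`. -/
lemma measure_halfLine_le {θ m : ℝ} {t : ℕ}
    (hint : Integrable (fun ω => Real.exp (θ * S t ω)) μ)
    (hmgf : ∫ ω, Real.exp (θ * S t ω) ∂μ = Real.exp (Λ t θ)) (ht : 0 < t) :
    μ.real {ω | m < θ * (S t ω / t) - Γ θ} ≤ Real.exp (Λ t θ - t * (m + Γ θ)) := by
  have h0 : (0 : ℝ) < t := by exact_mod_cast ht
  have h1 := mul_meas_ge_le_integral_of_nonneg
    (ae_of_all μ fun ω => (Real.exp_pos (θ * S t ω)).le) hint (Real.exp (t * (m + Γ θ)))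
  rw [hmgf] at h1
  have h2 : μ.real {ω | m < θ * (S t ω / t) - Γ θ} ≤
      μ.real {ω | Real.exp (t * (m + Γ θ)) ≤ Real.exp (θ * S t ω)} := by
    refine measureReal_mono fun ω hω => ?_
    simp only [Set.mem_ofPred_eq, Real.exp_le_exp] at hω ⊢
    have h3 : m + Γ θ < θ * S t ω / t := by rw [mul_div_assoc]; linarith
    rw [lt_div_iff₀ h0] at h3
    linarith
  rw [Real.exp_sub, le_div_iff₀ (Real.exp_pos _), mul_comm]
  exact (mul_le_mul_of_nonneg_left h2 (Real.exp_pos _).le).trans h1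

/-- Large deviation upper bound: each half-line `{y | m < θ * y - Γ θ}` has probability of
exponential order at most `-m`, and a closed set on which the rate exceeds `m` is covered by
finitely many of them. Two fixed parameters, one of each sign, take care of noncompactness. -/
lemma limsup_log_le_of_mgf (hc : 0 < θc) (hS : ∀ t, Measurable (S t))
    (hint : ∀ θ ≤ θc, ∀ t, Integrable (fun ω => Real.exp (θ * S t ω)) μ)
    (hmgf : ∀ θ ≤ θc, ∀ t, ∫ ω, Real.exp (θ * S t ω) ∂μ = Real.exp (Λ t θ))
    (hlim : ∀ θ ≤ θc, Tendsto (fun t : ℕ => (t : ℝ)⁻¹ * Λ t θ) atTop (𝓝 (Γ θ)))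
    {A : Set ℝ} (hA : MeasurableSet A) :
    limsup (fun t : ℕ => (((t : ℝ)⁻¹ : ℝ) : EReal) *
        ENNReal.log (μ.map (fun ω => S t ω / (t : ℝ)) A)) atTop ≤
      -(⨅ x ∈ closure A, ⨆ θ ∈ Set.Iic θc, ((θ * x - Γ θ : ℝ) : EReal)) := by
  refine EReal.le_of_forall_lt_iff_le.1 fun r hr => ?_
  rw [EReal.neg_lt_comm, ← EReal.coe_neg] at hr
  obtain ⟨m, hm1, hm2⟩ := EReal.lt_iff_exists_real_btwn.1 hr
  rw [EReal.coe_lt_coe_iff] at hm1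
  have hcov : ∀ x ∈ closure A, ∃ θ ≤ θc, m < θ * x - Γ θ := by
    intro x hx
    have h1 := hm2.trans_le (iInf₂_le x hx)
    simp only [lt_iSup_iff, EReal.coe_lt_coe_iff] at h1
    obtain ⟨θ, h2, h3⟩ := h1
    exact ⟨θ, h2, h3⟩
  -- Beyond `M` the parameter `θc` suffices, below `-M` the parameter `-1`.
  set M : ℝ := max ((|m| + |Γ θc| + 1) / θc) (|m| + |Γ (-1)| + 1)
  have hMc : ∀ x, M < x → m < θc * x - Γ θc := by
    intro x hx
    have h1 : (|m| + |Γ θc| + 1) / θc < x := (le_max_left _ _).trans_lt hx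
    rw [div_lt_iff₀ hc] at h1
    linarith [le_abs_self m, le_abs_self (Γ θc)]
  have hMn : ∀ x, x < -M → m < (-1) * x - Γ (-1) := by
    intro x hx
    have h1 : |m| + |Γ (-1)| + 1 ≤ M := le_max_right _ _
    linarith [le_abs_self m, le_abs_self (Γ (-1))]
  have hK : IsCompact (closure A ∩ Set.Icc (-M) M) := isCompact_Icc.inter_left isClosed_closure
  obtain ⟨b, hb⟩ := hK.elim_finite_subcover
    (fun θ : Set.Iic θc => {y : ℝ | m < θ.1 * y - Γ θ.1})
    (fun θ => isOpen_lt continuous_const (by fun_prop))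
    (fun x hx => by
      obtain ⟨θ, h1, h2⟩ := hcov x hx.1
      exact Set.mem_iUnion.2 ⟨⟨θ, h1⟩, h2⟩)
  classical
  let b' : Finset ℝ := insert θc (insert (-1) (b.image Subtype.val))
  have hb'c : ∀ θ ∈ b', θ ≤ θc := by
    intro θ hθ
    simp only [b', Finset.mem_insert, Finset.mem_image] at hθ
    rcases hθ with h | h | ⟨x, -, h⟩
    · exact h.le
    · linarith
    · exact h ▸ x.2
  have hAcov : A ⊆ ⋃ θ ∈ b', {y : ℝ | m < θ * y - Γ θ} := by
    intro x hx
    simp only [Set.mem_iUnion, Set.mem_ofPred_eq, exists_prop]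
    rcases lt_or_ge M x with h | h
    · exact ⟨θc, by simp [b'], hMc x h⟩
    rcases lt_or_ge x (-M) with h' | h'
    · exact ⟨-1, by simp [b'], hMn x h'⟩
    · obtain ⟨θ, hθ, h2⟩ := Set.mem_iUnion₂.1 (hb ⟨subset_closure hx, h', h⟩)
      exact ⟨θ.1, by simp only [b', Finset.mem_insert, Finset.mem_image]
                     exact Or.inr (Or.inr ⟨θ, hθ, rfl⟩), h2⟩
  refine limsup_log_le_of_eventually_le_exp ?_
  have hev : ∀ᶠ t : ℕ in atTop, ∀ θ ∈ b',
      (b'.card : ℝ) * Real.exp (Λ t θ - t * (m + Γ θ)) ≤ Real.exp (t * r) := by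
    rw [Finset.eventually_all]
    intro θ hθ
    refine eventually_const_mul_exp_le (c := -m) ?_ (by linarith)
    have h1 := (hlim θ (hb'c θ hθ)).sub_const (m + Γ θ)
    refine (h1.congr' ?_).trans (by rw [show Γ θ - (m + Γ θ) = -m by ring])
    filter_upwards [eventually_gt_atTop 0] with t ht
    have h0 : (t : ℝ) ≠ 0 := by positivity
    field_simp
  filter_upwards [hev, eventually_gt_atTop 0] with t ht ht0
  rw [Measure.map_apply ((hS t).div_const _) hA]
  have h1 : (fun ω => S t ω / (t : ℝ)) ⁻¹' A ⊆ ⋃ θ ∈ b', {ω | m < θ * (S t ω / t) - Γ θ} := by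
    intro ω hω
    simpa using hAcov hω
  rw [← ofReal_measureReal]
  refine ENNReal.ofReal_le_ofReal ?_
  have hbne : b'.Nonempty := ⟨θc, by simp [b']⟩
  have hcard : (0 : ℝ) < b'.card := by exact_mod_cast hbne.card_pos
  calc μ.real ((fun ω => S t ω / (t : ℝ)) ⁻¹' A)
      ≤ μ.real (⋃ θ ∈ b', {ω | m < θ * (S t ω / t) - Γ θ}) :=
        measureReal_mono h1 (measure_ne_top _ _)
    _ ≤ ∑ θ ∈ b', μ.real {ω | m < θ * (S t ω / t) - Γ θ} := measureReal_biUnion_finset_le _ _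
    _ ≤ ∑ θ ∈ b', Real.exp (t * r) / b'.card := by
        refine Finset.sum_le_sum fun θ hθ => ?_
        refine (measure_halfLine_le (hint θ (hb'c θ hθ) t) (hmgf θ (hb'c θ hθ) t) ht0).trans ?_
        rw [le_div_iff₀ hcard, mul_comm]
        exact ht θ hθ
    _ = Real.exp (t * r) := by
        rw [Finset.sum_const, nsmul_eq_mul, mul_div_cancel₀ _ hcard.ne']

/-- `x` is exposed at the parameter `θ` of `Γ` on `Iic θc`: if the line of slope `x` through
`(θ, Γ θ)` is tilted upwards, by however little, on one side of `θ`, then `Γ` goes strictly below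
it somewhere on that side. This holds when `θ < θc` and `Γ` has derivative `x` at `θ`, and it is
all that the lower bound uses. -/
def ExposedAt (Γ : ℝ → ℝ) (θc θ x : ℝ) : Prop :=
  ∀ δ > 0, (∃ ε > 0, θ + ε ≤ θc ∧ Γ (θ + ε) < Γ θ + ε * (x + δ)) ∧
    ∃ ε > 0, Γ (θ - ε) < Γ θ - ε * (x - δ)

/-- Large deviation lower bound near an exposed point. The exponential moment at `θ` is carried by
the event that `S t / t` is close to `x`, since the moments at `θ ± ε` bound the contributions from
either side. -/
lemma le_liminf_log_of_exposedAt (hS : ∀ t, Measurable (S t))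
    (hint : ∀ θ ≤ θc, ∀ t, Integrable (fun ω => Real.exp (θ * S t ω)) μ)
    (hmgf : ∀ θ ≤ θc, ∀ t, ∫ ω, Real.exp (θ * S t ω) ∂μ = Real.exp (Λ t θ))
    (hlim : ∀ θ ≤ θc, Tendsto (fun t : ℕ => (t : ℝ)⁻¹ * Λ t θ) atTop (𝓝 (Γ θ)))
    {θ x : ℝ} (hθ : θ ≤ θc) (hx : ExposedAt Γ θc θ x)
    {A : Set ℝ} (hA : MeasurableSet A) (hxA : x ∈ interior A) :
    ((-(θ * x - Γ θ) : ℝ) : EReal) ≤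
      liminf (fun t : ℕ => (((t : ℝ)⁻¹ : ℝ) : EReal) *
        ENNReal.log (μ.map (fun ω => S t ω / (t : ℝ)) A)) atTop := by
  refine EReal.ge_of_forall_gt_iff_ge.1 fun r hr => ?_
  rw [EReal.coe_lt_coe_iff] at hr
  obtain ⟨δ₀, hδ₀, hball⟩ := Metric.mem_nhds_iff.1 (mem_interior_iff_mem_nhds.1 hxA)
  -- `δ` is so small that the interval around `x` lies in `A` and costs less than `-r`.
  obtain ⟨δ, hδ, hδ1, hδ2⟩ : ∃ δ > 0, δ < δ₀ ∧ r < -(θ * x - Γ θ) - |θ| * δ := by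
    have h1 : Tendsto (fun δ : ℝ => -(θ * x - Γ θ) - |θ| * δ) (𝓝[>] 0) (𝓝 (-(θ * x - Γ θ))) := by
      have : ContinuousAt (fun δ : ℝ => -(θ * x - Γ θ) - |θ| * δ) 0 := by fun_prop
      simpa using this.tendsto.mono_left nhdsWithin_le_nhds
    obtain ⟨δ, h2, h3, h4⟩ := ((h1.eventually_const_lt hr).and
      ((eventually_nhdsWithin_of_eventually_nhds (eventually_lt_nhds hδ₀)).and
        self_mem_nhdsWithin)).exists
    exact ⟨δ, h4, h3, h2⟩
  obtain ⟨⟨ε, hε, hεc, hε1⟩, η, hη, hη1⟩ := hx δ hδ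
  refine le_liminf_log_of_eventually_exp_le ?_
  have lim0 := hlim θ hθ
  have key : ∀ (c s : ℝ) (φ : ℕ → ℝ),
      Tendsto (fun t : ℕ => (t : ℝ)⁻¹ * φ t) atTop (𝓝 c) → c + s < Γ θ →
      ∀ᶠ t : ℕ in atTop, 4 * Real.exp (φ t + t * s) ≤ Real.exp (Λ t θ) := by
    intro c s φ h1 h2
    have h3 : Tendsto (fun t : ℕ => (t : ℝ)⁻¹ * (φ t + t * s - Λ t θ)) atTop
        (𝓝 (c + s - Γ θ)) := by
      refine ((h1.add_const s).sub lim0).congr' ?_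
      filter_upwards [eventually_gt_atTop 0] with t ht
      have h0 : (t : ℝ) ≠ 0 := by positivity
      field_simp
    filter_upwards [eventually_const_mul_exp_le (K := 4) h3 (sub_neg.2 h2)] with t ht
    rw [mul_zero, Real.exp_zero, Real.exp_sub, ← mul_div_assoc,
      div_le_one (Real.exp_pos _)] at ht
    exact ht
  have ev1 := key _ (-(ε * (x + δ))) (fun t => Λ t (θ + ε)) (hlim _ hεc) (by linarith)
  have ev2 := key _ (η * (x - δ)) (fun t => Λ t (θ - η)) (hlim _ (by linarith)) (by linarith)
  have ev3 := key 0 (r + θ * x + |θ| * δ) (fun _ => 0) (by simp) (by linarith)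
  filter_upwards [ev1, ev2, ev3, eventually_gt_atTop 0] with t h1 h2 h3 ht0
  have h0 : (0 : ℝ) < t := by exact_mod_cast ht0
  rw [Measure.map_apply ((hS t).div_const _) hA, ← ofReal_measureReal]
  refine ENNReal.ofReal_le_ofReal ?_
  set B : Set Ω := (fun ω => S t ω / (t : ℝ)) ⁻¹' A with hB
  have hBm : MeasurableSet B := ((hS t).div_const _) hA
  have hpt : ∀ ω, Real.exp (θ * S t ω) ≤
      B.indicator (fun _ => Real.exp (t * (θ * x + |θ| * δ))) ω +
      Real.exp (-(t * (ε * (x + δ)))) * Real.exp ((θ + ε) * S t ω) +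
      Real.exp (t * (η * (x - δ))) * Real.exp ((θ - η) * S t ω) := by
    intro ω
    have hi : 0 ≤ B.indicator (fun _ => Real.exp (t * (θ * x + |θ| * δ))) ω :=
      Set.indicator_nonneg (fun _ _ => (Real.exp_pos _).le) _
    rw [← Real.exp_add, ← Real.exp_add]
    rcases le_or_gt (t * (x + δ)) (S t ω) with h | h
    · have : θ * S t ω ≤ -(t * (ε * (x + δ))) + (θ + ε) * S t ω := by
        nlinarith [mul_le_mul_of_nonneg_left h hε.le]
      linarith [Real.exp_le_exp.2 this, Real.exp_pos (t * (η * (x - δ)) + (θ - η) * S t ω)]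
    rcases le_or_gt (S t ω) (t * (x - δ)) with h' | h'
    · have : θ * S t ω ≤ t * (η * (x - δ)) + (θ - η) * S t ω := by
        nlinarith [mul_le_mul_of_nonneg_left h' hη.le]
      linarith [Real.exp_le_exp.2 this, Real.exp_pos (-(t * (ε * (x + δ))) + (θ + ε) * S t ω)]
    · have habs : |S t ω - t * x| ≤ t * δ := abs_le.2 ⟨by linarith, by linarith⟩
      have hmem : ω ∈ B := by
        apply hball
        rw [Metric.mem_ball, Real.dist_eq]
        have : |S t ω / t - x| ≤ δ := by
          rw [show S t ω / t - x = (S t ω - t * x) / t by field_simp, abs_div, abs_of_pos h0,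
            div_le_iff₀ h0]
          linarith
        linarith
      rw [Set.indicator_of_mem hmem]
      have : θ * S t ω ≤ t * (θ * x + |θ| * δ) := by
        have h4 : θ * (S t ω - t * x) ≤ |θ| * (t * δ) :=
          (le_abs_self _).trans (by rw [abs_mul]; gcongr)
        nlinarith
      linarith [Real.exp_le_exp.2 this, Real.exp_pos (t * (η * (x - δ)) + (θ - η) * S t ω),
        Real.exp_pos (-(t * (ε * (x + δ))) + (θ + ε) * S t ω)]
  have i1 : Integrable (B.indicator (fun _ => Real.exp (t * (θ * x + |θ| * δ)))) μ :=
    (integrable_const _).indicator hBm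
  have i2 := (hint (θ + ε) hεc t).const_mul (Real.exp (-(t * (ε * (x + δ)))))
  have i3 := (hint (θ - η) (by linarith) t).const_mul (Real.exp (t * (η * (x - δ))))
  have hI := integral_mono (hint θ hθ t) ((i1.add i2).add i3) hpt
  simp only [Pi.add_apply] at hI
  rw [hmgf θ hθ, integral_add (by exact i1.add i2) i3, integral_add i1 i2,
    integral_const_mul, integral_const_mul, hmgf _ hεc, hmgf _ (by linarith),
    integral_indicator_const _ hBm, ← Real.exp_add, ← Real.exp_add, smul_eq_mul] at hI
  have e1 : -(t * (ε * (x + δ))) + Λ t (θ + ε) = Λ t (θ + ε) + t * -(ε * (x + δ)) := by ring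
  have e2 : t * (η * (x - δ)) + Λ t (θ - η) = Λ t (θ - η) + t * (η * (x - δ)) := by ring
  rw [e1, e2] at hI
  rw [zero_add, show (t : ℝ) * (r + θ * x + |θ| * δ) = t * r + t * (θ * x + |θ| * δ) by ring,
    Real.exp_add] at h3
  have h5 : Real.exp (t * r) * Real.exp (t * (θ * x + |θ| * δ)) ≤
      μ.real B * Real.exp (t * (θ * x + |θ| * δ)) := by
    linarith [Real.exp_pos (Λ t θ)]
  exact le_of_mul_le_mul_right h5 (Real.exp_pos _)

end LargeDeviations

/-! ### A nonlinear renewal recursion -/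

section Renewal

/-- The solution of the nonlinear renewal recursion
`f k = θ + ∑_{i < k} α (k - i) * H (f i)`. -/
noncomputable def renewalSeq (α : ℕ → ℝ) (H : ℝ → ℝ) (θ : ℝ) : ℕ → ℝ
  | k => θ + ∑ i : Fin k, α (k - i) * H (renewalSeq α H θ i)

variable {α : ℕ → ℝ} {H : ℝ → ℝ} {θ u : ℝ}

lemma renewalSeq_eq (k : ℕ) :
    renewalSeq α H θ k = θ + ∑ i ∈ Finset.range k, α (k - i) * H (renewalSeq α H θ i) := by
  rw [renewalSeq, Finset.sum_range (fun i => α (k - i) * H (renewalSeq α H θ i))]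

lemma renewalSeq_neg (k : ℕ) :
    renewalSeq α (fun x => -H (-x)) (-θ) k = -renewalSeq α H θ k := by
  induction k using Nat.strong_induction_on with
  | _ k ih =>
    rw [renewalSeq_eq, renewalSeq_eq (H := H), neg_add, ← Finset.sum_neg_distrib]
    congr 1
    refine Finset.sum_congr rfl fun i hi => ?_
    rw [ih i (Finset.mem_range.1 hi)]
    simp

lemma sum_range_comp_sub_eq (g : ℕ → ℕ → ℝ) (k : ℕ) :
    ∑ i ∈ Finset.range k, g (k - i) i = ∑ j ∈ Finset.range k, g (j + 1) (k - 1 - j) := by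
  rw [← Finset.sum_range_reflect]
  refine Finset.sum_congr rfl fun j hj => ?_
  have := Finset.mem_range.1 hj
  congr 1
  omega

lemma sum_range_comp_sub_le (hα : ∀ t, 1 ≤ t → 0 ≤ α t)
    (hsum : Summable fun t : ℕ => α (t + 1)) (k : ℕ) :
    ∑ i ∈ Finset.range k, α (k - i) ≤ ∑' t : ℕ, α (t + 1) := by
  rw [sum_range_comp_sub_eq (fun x _ => α x)]
  exact hsum.sum_le_tsum _ fun i _ => hα _ (by omega)

lemma renewalSeq_mem_Icc (hα : ∀ t, 1 ≤ t → 0 ≤ α t)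
    (hsum : Summable fun t : ℕ => α (t + 1)) (hH : MonotoneOn H (Set.Icc 0 u)) (hH0 : H 0 = 0)
    (hθ : 0 ≤ θ) (hu : 0 ≤ u) (hfix : u = θ + (∑' t : ℕ, α (t + 1)) * H u) (k : ℕ) :
    renewalSeq α H θ k ∈ Set.Icc 0 u := by
  induction k using Nat.strong_induction_on with
  | _ k ih =>
    have h0 : ∀ i ∈ Finset.range k, 0 ≤ H (renewalSeq α H θ i) := fun i hi => by
      have h := ih i (Finset.mem_range.1 hi)
      exact hH0 ▸ hH ⟨le_rfl, hu⟩ h h.1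
    have hα' : ∀ i ∈ Finset.range k, 0 ≤ α (k - i) := fun i hi =>
      hα _ (by have := Finset.mem_range.1 hi; omega)
    rw [renewalSeq_eq]
    refine ⟨add_nonneg hθ (Finset.sum_nonneg fun i hi => mul_nonneg (hα' i hi) (h0 i hi)), ?_⟩
    have hHu : 0 ≤ H u := hH0 ▸ hH ⟨le_rfl, hu⟩ ⟨hu, le_rfl⟩ hu
    calc θ + ∑ i ∈ Finset.range k, α (k - i) * H (renewalSeq α H θ i)
        ≤ θ + ∑ i ∈ Finset.range k, α (k - i) * H u := by
          gcongr with i hi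
          · exact hα' i hi
          · have h := ih i (Finset.mem_range.1 hi)
            exact hH h ⟨hu, le_rfl⟩ h.2
      _ ≤ θ + (∑' t : ℕ, α (t + 1)) * H u := by
          rw [← Finset.sum_mul]
          gcongr
          exact sum_range_comp_sub_le hα hsum k
      _ = u := hfix.symm

lemma renewalSeq_monotone (hα : ∀ t, 1 ≤ t → 0 ≤ α t)
    (hsum : Summable fun t : ℕ => α (t + 1)) (hH : MonotoneOn H (Set.Icc 0 u)) (hH0 : H 0 = 0)
    (hθ : 0 ≤ θ) (hu : 0 ≤ u) (hfix : u = θ + (∑' t : ℕ, α (t + 1)) * H u) :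
    Monotone (renewalSeq α H θ) := by
  have hmem := renewalSeq_mem_Icc hα hsum hH hH0 hθ hu hfix
  refine monotone_nat_of_le_succ fun k => ?_
  induction k using Nat.strong_induction_on with
  | _ k ih =>
    rw [renewalSeq_eq, renewalSeq_eq (k + 1), Finset.sum_range_succ']
    have h0 : 0 ≤ α (k + 1 - 0) * H (renewalSeq α H θ 0) :=
      mul_nonneg (hα _ (by omega)) (hH0 ▸ hH ⟨le_rfl, hu⟩ (hmem 0) (hmem 0).1)
    have h1 : ∑ i ∈ Finset.range k, α (k - i) * H (renewalSeq α H θ i) ≤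
        ∑ i ∈ Finset.range k, α (k + 1 - (i + 1)) * H (renewalSeq α H θ (i + 1)) := by
      refine Finset.sum_le_sum fun i hi => ?_
      have hik := Finset.mem_range.1 hi
      rw [Nat.add_sub_add_right]
      exact mul_le_mul_of_nonneg_left (hH (hmem _) (hmem _) (ih i hik)) (hα _ (by omega))
    linarith

/-- From a nonnegative start the recursion increases to the fixed point. -/
lemma tendsto_renewalSeq_of_nonneg (hα : ∀ t, 1 ≤ t → 0 ≤ α t)
    (hsum : Summable fun t : ℕ => α (t + 1)) (hH : MonotoneOn H (Set.Icc 0 u))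
    (hHc : ContinuousOn H (Set.Icc 0 u)) (hH0 : H 0 = 0)
    (hθ : 0 ≤ θ) (hu : 0 ≤ u) (hfix : u = θ + (∑' t : ℕ, α (t + 1)) * H u)
    (huniq : ∀ v ∈ Set.Icc 0 u, v = θ + (∑' t : ℕ, α (t + 1)) * H v → v = u) :
    Tendsto (renewalSeq α H θ) atTop (𝓝 u) := by
  have hmem := renewalSeq_mem_Icc hα hsum hH hH0 hθ hu hfix
  have hmono := renewalSeq_monotone hα hsum hH hH0 hθ hu hfix
  obtain ⟨v, hv⟩ : ∃ v, Tendsto (renewalSeq α H θ) atTop (𝓝 v) :=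
    ⟨_, tendsto_atTop_ciSup hmono ⟨u, by rintro _ ⟨k, rfl⟩; exact (hmem k).2⟩⟩
  have hvmem : v ∈ Set.Icc 0 u := isClosed_Icc.mem_of_tendsto hv (Eventually.of_forall hmem)
  have hHv : Tendsto (fun k => H (renewalSeq α H θ k)) atTop (𝓝 (H v)) :=
    (hHc v hvmem).tendsto.comp
      (tendsto_nhdsWithin_iff.2 ⟨hv, Eventually.of_forall hmem⟩)
  have hHn : ∀ k, 0 ≤ H (renewalSeq α H θ k) := fun k =>
    hH0 ▸ hH ⟨le_rfl, hu⟩ (hmem k) (hmem k).1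
  have hHle : ∀ k, H (renewalSeq α H θ k) ≤ H u := fun k =>
    hH (hmem k) ⟨hu, le_rfl⟩ (hmem k).2
  have hT : Tendsto (fun k : ℕ => ∑' j : ℕ, if j < k then
      α (j + 1) * H (renewalSeq α H θ (k - 1 - j)) else 0) atTop
      (𝓝 (∑' j : ℕ, α (j + 1) * H v)) := by
    refine tendsto_tsum_of_dominated_convergence (bound := fun j => α (j + 1) * H u)
      (hsum.mul_right _) (fun j => ?_) (Eventually.of_forall fun k j => ?_)
    · have h1 : Tendsto (fun k : ℕ => k - 1 - j) atTop atTop :=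
        (tendsto_sub_atTop_nat j).comp (tendsto_sub_atTop_nat 1)
      refine ((hHv.comp h1).const_mul (α (j + 1))).congr' ?_
      filter_upwards [eventually_gt_atTop j] with k hk
      rw [if_pos hk, Function.comp_apply]
    · have h2 : 0 ≤ α (j + 1) := hα _ (by omega)
      split_ifs
      · rw [Real.norm_of_nonneg (mul_nonneg h2 (hHn _))]
        exact mul_le_mul_of_nonneg_left (hHle _) h2
      · rw [norm_zero]
        exact mul_nonneg h2 ((hHn 0).trans (hHle 0))
  have hf : ∀ k, renewalSeq α H θ k = θ + ∑' j : ℕ, if j < k then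
      α (j + 1) * H (renewalSeq α H θ (k - 1 - j)) else 0 := by
    intro k
    rw [renewalSeq_eq, sum_range_comp_sub_eq (fun x i => α x * H (renewalSeq α H θ i)),
      tsum_eq_sum (s := Finset.range k) fun j hj => if_neg (by simpa using hj)]
    congr 1
    exact Finset.sum_congr rfl fun j hj => (if_pos (Finset.mem_range.1 hj)).symm
  have hlim : Tendsto (renewalSeq α H θ) atTop (𝓝 (θ + (∑' t : ℕ, α (t + 1)) * H v)) := by
    rw [← tsum_mul_right]
    exact (hT.const_add θ).congr fun k => (hf k).symm
  rwa [← huniq v hvmem (tendsto_nhds_unique hv hlim)]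

/-- The recursion converges to the fixed point on the branch `Iic c`, on which `v - a * H v` is
strictly increasing, and never leaves this branch. The sign of `θ` decides whether it increases
or decreases; the reflection `x ↦ -x` exchanges the two cases. -/
lemma renewalSeq_le_and_tendsto {c : ℝ} (hα : ∀ t, 1 ≤ t → 0 ≤ α t)
    (hsum : Summable fun t : ℕ => α (t + 1)) (hc : 0 ≤ c) (hH : MonotoneOn H (Set.Iic c))
    (hHc : ContinuousOn H (Set.Iic c)) (hH0 : H 0 = 0)
    (hψ : StrictMonoOn (fun v => v - (∑' t : ℕ, α (t + 1)) * H v) (Set.Iic c))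
    (huc : u ≤ c) (hfix : u - (∑' t : ℕ, α (t + 1)) * H u = θ) :
    (∀ k, renewalSeq α H θ k ≤ c) ∧ Tendsto (renewalSeq α H θ) atTop (𝓝 u) := by
  have hψ0 : (0 : ℝ) - (∑' t : ℕ, α (t + 1)) * H 0 = 0 := by rw [hH0]; ring
  rcases le_total 0 u with hu | hu
  · have hsub : Set.Icc 0 u ⊆ Set.Iic c := fun v hv => hv.2.trans huc
    have hθ : 0 ≤ θ := by
      have := hψ.monotoneOn (Set.mem_Iic.2 hc) (Set.mem_Iic.2 huc) hu
      simp only [hψ0, hfix] at this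
      exact this
    refine ⟨fun k => hsub (renewalSeq_mem_Icc hα hsum (hH.mono hsub) hH0 hθ hu (by linarith) k),
      tendsto_renewalSeq_of_nonneg hα hsum (hH.mono hsub) (hHc.mono hsub) hH0 hθ hu (by linarith)
        fun v hv hfv => hψ.injOn (hsub hv) (Set.mem_Iic.2 huc) ?_⟩
    simp only [hfix]
    linarith
  · have hneg : ∀ v ∈ Set.Icc 0 (-u), -v ∈ Set.Iic c := fun v hv =>
      Set.mem_Iic.2 (by linarith [hv.1])
    have hθ : θ ≤ 0 := by
      have := hψ.monotoneOn (Set.mem_Iic.2 huc) (Set.mem_Iic.2 hc) hu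
      simp only [hψ0, hfix] at this
      exact this
    have hm : MonotoneOn (fun x => -H (-x)) (Set.Icc 0 (-u)) := fun v hv w hw hvw =>
      neg_le_neg (hH (hneg w hw) (hneg v hv) (neg_le_neg hvw))
    have hcont : ContinuousOn (fun x => -H (-x)) (Set.Icc 0 (-u)) :=
      (hHc.comp continuousOn_neg hneg).neg
    have hfix' : -u = -θ + (∑' t : ℕ, α (t + 1)) * -H (- -u) := by rw [neg_neg]; linarith
    have h0' : -H (-0) = 0 := by rw [neg_zero, hH0, neg_zero]
    have hb := renewalSeq_mem_Icc hα hsum hm h0' (by linarith) (by linarith) hfix'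
    have ht := tendsto_renewalSeq_of_nonneg hα hsum hm hcont h0' (by linarith) (by linarith) hfix'
      fun v hv hfv => by
        have := hψ.injOn (hneg v hv) (Set.mem_Iic.2 huc) (by simp only [hfix]; linarith)
        linarith
    simp only [renewalSeq_neg, Set.mem_Icc] at hb
    refine ⟨fun k => by linarith [(hb k).1], ?_⟩
    have := ht.neg
    simpa only [renewalSeq_neg, neg_neg] using this

end Renewal

/-! ### The moment generating function of a positive mark -/

section Mark

variable {Ω : Type*} [MeasurableSpace Ω] {μ : Measure Ω} {Y : Ω → ℝ} {a c u : ℝ}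

/-- `E[Y exp (u Y)]`, the derivative of the moment generating function of `Y` at points interior
to its domain. -/
noncomputable def mgfDeriv (Y : Ω → ℝ) (μ : Measure Ω) (u : ℝ) : ℝ :=
  ∫ ω, Y ω * Real.exp (u * Y ω) ∂μ

section Basic

lemma integrable_exp_mul_of_le_of_pos [IsProbabilityMeasure μ] (hY : AEMeasurable Y μ)
    (hpos : ∀ᵐ ω ∂μ, 0 < Y ω)
    (hc : Integrable (fun ω => Real.exp (c * Y ω)) μ) (hu : u ≤ c) :
    Integrable (fun ω => Real.exp (u * Y ω)) μ := by
  refine hc.mono' (by fun_prop) ?_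
  filter_upwards [hpos] with ω hω
  rw [Real.norm_of_nonneg (Real.exp_pos _).le]
  gcongr

lemma integrable_mul_exp_mul_of_le_of_pos (hY : AEMeasurable Y μ) (hpos : ∀ᵐ ω ∂μ, 0 < Y ω)
    (hc : Integrable (fun ω => Y ω * Real.exp (c * Y ω)) μ) (hu : u ≤ c) :
    Integrable (fun ω => Y ω * Real.exp (u * Y ω)) μ := by
  refine hc.mono' (by fun_prop) ?_
  filter_upwards [hpos] with ω hω
  rw [Real.norm_of_nonneg (by positivity)]
  gcongr

lemma mgf_monotoneOn [IsProbabilityMeasure μ] (hY : AEMeasurable Y μ)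
    (hpos : ∀ᵐ ω ∂μ, 0 < Y ω) (hc : Integrable (fun ω => Real.exp (c * Y ω)) μ) :
    MonotoneOn (mgf Y μ) (Set.Iic c) := by
  intro u hu v hv huv
  refine integral_mono_ae (integrable_exp_mul_of_le_of_pos hY hpos hc hu)
    (integrable_exp_mul_of_le_of_pos hY hpos hc hv) ?_
  filter_upwards [hpos] with ω hω
  gcongr

lemma mgf_continuousOn [IsProbabilityMeasure μ] (hY : AEMeasurable Y μ)
    (hpos : ∀ᵐ ω ∂μ, 0 < Y ω) (hc : Integrable (fun ω => Real.exp (c * Y ω)) μ) :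
    ContinuousOn (mgf Y μ) (Set.Iic c) := by
  refine continuousOn_of_dominated (F := fun u ω => Real.exp (u * Y ω))
    (fun u _ => by fun_prop) (fun u hu => ?_) hc
    (ae_of_all _ fun ω => by fun_prop)
  filter_upwards [hpos] with ω hω
  rw [Real.norm_of_nonneg (Real.exp_pos _).le]
  have := Set.mem_Iic.1 hu
  gcongr

lemma mgfDeriv_continuousOn (hY : AEMeasurable Y μ) (hpos : ∀ᵐ ω ∂μ, 0 < Y ω)
    (hc : Integrable (fun ω => Y ω * Real.exp (c * Y ω)) μ) :
    ContinuousOn (mgfDeriv Y μ) (Set.Iic c) := by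
  refine continuousOn_of_dominated (F := fun u ω => Y ω * Real.exp (u * Y ω))
    (fun u _ => by fun_prop) (fun u hu => ?_) hc
    (ae_of_all _ fun ω => by fun_prop)
  filter_upwards [hpos] with ω hω
  rw [Real.norm_of_nonneg (by positivity)]
  have := Set.mem_Iic.1 hu
  gcongr

lemma integral_pos_of_ae_pos [NeZero μ] {f : Ω → ℝ} (hf : Integrable f μ)
    (hpos : ∀ᵐ ω ∂μ, 0 < f ω) : 0 < ∫ ω, f ω ∂μ := by
  rw [integral_pos_iff_support_of_nonneg_ae (hpos.mono fun _ h => h.le) hf, pos_iff_ne_zero]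
  intro h0
  have h1 : ∀ᵐ ω ∂μ, ω ∉ Function.support f := measure_eq_zero_iff_ae_notMem.1 h0
  obtain ⟨ω, h2, h3⟩ := (h1.and hpos).exists
  exact h2 h3.ne'

lemma mgfDeriv_strictMonoOn [IsProbabilityMeasure μ] (hY : AEMeasurable Y μ)
    (hpos : ∀ᵐ ω ∂μ, 0 < Y ω) (hc : Integrable (fun ω => Y ω * Real.exp (c * Y ω)) μ) :
    StrictMonoOn (mgfDeriv Y μ) (Set.Iic c) := by
  intro u hu v hv huv
  have iu := integrable_mul_exp_mul_of_le_of_pos hY hpos hc hu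
  have iv := integrable_mul_exp_mul_of_le_of_pos hY hpos hc hv
  rw [← sub_pos, mgfDeriv, mgfDeriv, ← integral_sub iv iu]
  refine integral_pos_of_ae_pos (iv.sub iu) ?_
  filter_upwards [hpos] with ω hω
  rw [sub_pos]
  gcongr

lemma tendsto_mgfDeriv_atBot (hY : Integrable Y μ) (hpos : ∀ᵐ ω ∂μ, 0 < Y ω) :
    Tendsto (mgfDeriv Y μ) atBot (𝓝 0) := by
  have hm := hY.aemeasurable
  have h := tendsto_integral_filter_of_dominated_convergence (μ := μ) (l := (atBot : Filter ℝ))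
    (F := fun u ω => Y ω * Real.exp (u * Y ω)) (f := fun _ => 0) Y
    (Eventually.of_forall fun u => by fun_prop) ?_ hY ?_
  · rw [integral_zero] at h
    exact h
  · filter_upwards [eventually_le_atBot 0] with u hu
    filter_upwards [hpos] with ω hω
    rw [Real.norm_of_nonneg (by positivity)]
    exact mul_le_of_le_one_right hω.le
      (Real.exp_le_one_iff.2 (mul_nonpos_of_nonpos_of_nonneg hu hω.le))
  · filter_upwards [hpos] with ω hω
    simpa using (Real.tendsto_exp_atBot.comp (tendsto_id.atBot_mul_const hω)).const_mul (Y ω)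

lemma mem_interior_integrableExpSet_of_lt [IsProbabilityMeasure μ] (hY : AEMeasurable Y μ)
    (hpos : ∀ᵐ ω ∂μ, 0 < Y ω) (hc : Integrable (fun ω => Real.exp (c * Y ω)) μ) (hu : u < c) :
    u ∈ interior (integrableExpSet Y μ) :=
  mem_interior.2 ⟨Set.Iio c, fun _ hv => integrable_exp_mul_of_le_of_pos hY hpos hc
    (Set.mem_Iio.1 hv).le, isOpen_Iio, hu⟩

end Basic

/-- The data of a critical parameter `c`: the mark `Y` is positive with `a E[Y] < 1`, its
exponential moments at `c` are finite, and `a E[Y exp (c Y)] = 1`. In terms of a critical pair,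
`c = θ_c + a (x_c - 1)`. -/
structure IsCriticalTilt (μ : Measure Ω) (a : ℝ) (Y : Ω → ℝ) (c : ℝ) : Prop where
  pos : ∀ᵐ ω ∂μ, 0 < Y ω
  integrable : Integrable Y μ
  coeff_pos : 0 < a
  subcritical : a * ∫ ω, Y ω ∂μ < 1
  integrable_exp : Integrable (fun ω => Real.exp (c * Y ω)) μ
  integrable_mul_exp : Integrable (fun ω => Y ω * Real.exp (c * Y ω)) μ
  critical : a * mgfDeriv Y μ c = 1

/-- The parameter `θ = u - a (E[exp (u Y)] - 1)` for which `E[exp (u Y)]` solves the fixed point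
equation `x = E[exp (θ Y + a Y (x - 1))]`. -/
noncomputable def tiltParam (μ : Measure Ω) (a : ℝ) (Y : Ω → ℝ) (u : ℝ) : ℝ :=
  u - a * (mgf Y μ u - 1)

/-- A critical parameter exists when the moment generating function is unbounded on its domain:
by convexity its slope cannot stay below `a⁻¹`. -/
lemma exists_isCriticalTilt [IsProbabilityMeasure μ] (hint : Integrable Y μ)
    (hpos : ∀ᵐ ω ∂μ, 0 < Y ω) (ha : 0 < a) (hsub : a * ∫ ω, Y ω ∂μ < 1)
    (hunb : ∀ C : ℝ, ∃ u, Integrable (fun ω => Real.exp (u * Y ω)) μ ∧ C ≤ mgf Y μ u) :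
    ∃ c, IsCriticalTilt μ a Y c := by
  have hY := hint.aemeasurable
  suffices h : ∃ v, 0 ≤ v ∧ Integrable (fun ω => Real.exp (v * Y ω)) μ ∧
      Integrable (fun ω => Y ω * Real.exp (v * Y ω)) μ ∧ 1 / a ≤ mgfDeriv Y μ v by
    obtain ⟨v, hv0, h1, h2, h3⟩ := h
    have h0 : mgfDeriv Y μ 0 ≤ 1 / a := by
      rw [le_div_iff₀ ha, mul_comm]
      simpa [mgfDeriv] using hsub.le
    obtain ⟨c, hc, hc'⟩ := intermediate_value_Icc hv0
      ((mgfDeriv_continuousOn hY hpos h2).mono Set.Icc_subset_Iic_self) ⟨h0, h3⟩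
    exact ⟨c, hpos, hint, ha, hsub, integrable_exp_mul_of_le_of_pos hY hpos h1 hc.2,
      integrable_mul_exp_mul_of_le_of_pos hY hpos h2 hc.2, by rw [hc']; field_simp⟩
  have hlt : ∀ {v w : ℝ}, Integrable (fun ω => Real.exp (w * Y ω)) μ → v < w →
      Integrable (fun ω => Y ω * Real.exp (v * Y ω)) μ := fun hw hvw => by
    simpa using integrable_pow_mul_exp_of_mem_interior_integrableExpSet
      (mem_interior_integrableExpSet_of_lt hY hpos hw hvw) 1
  by_cases hb : BddAbove (integrableExpSet Y μ)
  · -- On a bounded domain, `E[exp (v Y)] - 1 ≤ v * E[Y exp (v Y)]` forces a large slope.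
    obtain ⟨b, hb⟩ := hb
    obtain ⟨w, hw, hCw⟩ := hunb (2 + |b| / a)
    have hba : 0 ≤ |b| / a := by positivity
    have hw0 : 0 < w := by
      by_contra! h
      have h1 := mgf_monotoneOn (c := 0) hY hpos (by simp) (Set.mem_Iic.2 h)
        (Set.mem_Iic.2 le_rfl) h
      rw [mgf_zero] at h1
      linarith
    have hcont : ContinuousWithinAt (mgf Y μ) (Set.Iio w) w :=
      ((mgf_continuousOn hY hpos hw) w (Set.mem_Iic.2 le_rfl)).mono Set.Iio_subset_Iic_self
    obtain ⟨v, hv1, hv2, hv0⟩ := ((hcont.tendsto.eventually_const_lt (sub_one_lt (mgf Y μ w))).and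
      (eventually_mem_nhdsWithin.and
        (eventually_nhdsWithin_of_eventually_nhds (eventually_gt_nhds hw0)))).exists
    have hv2 : v < w := hv2
    have iv := integrable_exp_mul_of_le_of_pos hY hpos hw hv2.le
    have iv' := hlt hw hv2
    refine ⟨v, hv0.le, iv, iv', ?_⟩
    have hvb : v ≤ |b| := (hb iv).trans (le_abs_self b)
    have hconv : mgf Y μ v - 1 ≤ v * mgfDeriv Y μ v := by
      have h1 : ∫ ω, (Real.exp (v * Y ω) - v * (Y ω * Real.exp (v * Y ω))) ∂μ ≤ ∫ _, 1 ∂μ := by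
        refine integral_mono (iv.sub (iv'.const_mul v)) (integrable_const _) fun ω => ?_
        have h2 := Real.add_one_le_exp (-(v * Y ω))
        have h3 := mul_le_mul_of_nonneg_right h2 (Real.exp_pos (v * Y ω)).le
        rw [← Real.exp_add, neg_add_cancel, Real.exp_zero] at h3
        simp only
        linarith
      rw [integral_sub iv (iv'.const_mul v), integral_const_mul] at h1
      simp only [integral_const, probReal_univ, smul_eq_mul, mul_one] at h1
      rw [mgf, mgfDeriv]
      linarith
    have h1 : v / a ≤ v * mgfDeriv Y μ v :=
      calc v / a ≤ |b| / a := by gcongr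
        _ ≤ v * mgfDeriv Y μ v := by linarith
    rw [div_eq_mul_one_div] at h1
    exact le_of_mul_le_mul_left h1 hv0
  · -- On the whole line, `E[Y exp (v Y)] ≥ v * E[Y ^ 2]`.
    have hall : ∀ u, Integrable (fun ω => Real.exp (u * Y ω)) μ := by
      intro u
      obtain ⟨w, hw, huw⟩ := not_bddAbove_iff.1 hb u
      exact integrable_exp_mul_of_le_of_pos hY hpos hw huw.le
    have i2 : Integrable (fun ω => Y ω ^ 2) μ :=
      integrable_pow_of_mem_interior_integrableExpSet
        (mem_interior_integrableExpSet_of_lt hY hpos (hall 1) one_pos) 2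
    have h2 : 0 < ∫ ω, Y ω ^ 2 ∂μ :=
      integral_pos_of_ae_pos i2 (hpos.mono fun _ h => pow_pos h 2)
    have iv := hlt (hall (1 / (a * ∫ ω, Y ω ^ 2 ∂μ) + 1)) (lt_add_one _)
    refine ⟨1 / (a * ∫ ω, Y ω ^ 2 ∂μ), by positivity, hall _, iv, ?_⟩
    calc 1 / a = ∫ ω, 1 / (a * ∫ ω, Y ω ^ 2 ∂μ) * Y ω ^ 2 ∂μ := by
          rw [integral_const_mul]
          field_simp
      _ ≤ mgfDeriv Y μ (1 / (a * ∫ ω, Y ω ^ 2 ∂μ)) := by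
          refine integral_mono_ae (i2.const_mul _) iv ?_
          filter_upwards [hpos] with ω hω
          have h3 := Real.add_one_le_exp (1 / (a * ∫ ω, Y ω ^ 2 ∂μ) * Y ω)
          have h4 := mul_le_mul_of_nonneg_left h3 hω.le
          nlinarith

namespace IsCriticalTilt

variable [IsProbabilityMeasure μ] (h : IsCriticalTilt μ a Y c)

include h

lemma integrable_exp_of_le (hu : u ≤ c) : Integrable (fun ω => Real.exp (u * Y ω)) μ :=
  integrable_exp_mul_of_le_of_pos h.integrable.aemeasurable h.pos h.integrable_exp hu

lemma mgf_monotoneOn : MonotoneOn (mgf Y μ) (Set.Iic c) :=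
  _root_.mgf_monotoneOn h.integrable.aemeasurable h.pos h.integrable_exp

lemma mgf_continuousOn : ContinuousOn (mgf Y μ) (Set.Iic c) :=
  _root_.mgf_continuousOn h.integrable.aemeasurable h.pos h.integrable_exp

lemma mgfDeriv_strictMonoOn : StrictMonoOn (mgfDeriv Y μ) (Set.Iic c) :=
  _root_.mgfDeriv_strictMonoOn h.integrable.aemeasurable h.pos h.integrable_mul_exp

lemma hasDerivAt_mgf (hu : u < c) : HasDerivAt (mgf Y μ) (mgfDeriv Y μ u) u :=
  ProbabilityTheory.hasDerivAt_mgf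
    (mem_interior_integrableExpSet_of_lt h.integrable.aemeasurable h.pos h.integrable_exp hu)

lemma mul_mgfDeriv_lt_one (hu : u < c) : a * mgfDeriv Y μ u < 1 := by
  rw [← h.critical]
  exact mul_lt_mul_of_pos_left (h.mgfDeriv_strictMonoOn hu.le (Set.mem_Iic.2 le_rfl) hu) h.coeff_pos

lemma tilt_pos : 0 < c := by
  by_contra! hc
  have h1 := (_root_.mgfDeriv_strictMonoOn (c := 0) h.integrable.aemeasurable h.pos
    (by simpa using h.integrable)).monotoneOn (Set.mem_Iic.2 hc) (Set.mem_Iic.2 le_rfl) hc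
  have h2 : mgfDeriv Y μ 0 = ∫ ω, Y ω ∂μ := by simp [mgfDeriv]
  have h3 := mul_le_mul_of_nonneg_left h1 h.coeff_pos.le
  rw [h.critical, h2] at h3
  linarith [h.subcritical]

lemma eq_of_isCriticalTilt {c' : ℝ} (h' : IsCriticalTilt μ a Y c') : c' = c := by
  rcases le_total c' c with hcc | hcc
  · exact h.mgfDeriv_strictMonoOn.injOn hcc (Set.mem_Iic.2 le_rfl)
      (mul_left_cancel₀ h.coeff_pos.ne' (h'.critical.trans h.critical.symm))
  · exact (h'.mgfDeriv_strictMonoOn.injOn hcc (Set.mem_Iic.2 le_rfl)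
      (mul_left_cancel₀ h.coeff_pos.ne' (h.critical.trans h'.critical.symm))).symm

omit h in
lemma tiltParam_zero : tiltParam μ a Y 0 = 0 := by simp [tiltParam]

lemma hasDerivAt_tiltParam (hu : u < c) :
    HasDerivAt (tiltParam μ a Y) (1 - a * mgfDeriv Y μ u) u :=
  (hasDerivAt_id u).sub (((h.hasDerivAt_mgf hu).sub_const 1).const_mul a)

lemma tiltParam_continuousOn : ContinuousOn (tiltParam μ a Y) (Set.Iic c) :=
  continuousOn_id.sub ((h.mgf_continuousOn.sub continuousOn_const).const_smul a)

/-- `tiltParam` is concave with its maximum at `c`, where its derivative `1 - a E[Y exp (u Y)]`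
vanishes. -/
lemma tiltParam_strictMonoOn : StrictMonoOn (tiltParam μ a Y) (Set.Iic c) := by
  refine strictMonoOn_of_deriv_pos (convex_Iic c) h.tiltParam_continuousOn fun u hu => ?_
  rw [interior_Iic] at hu
  rw [(h.hasDerivAt_tiltParam hu).deriv, sub_pos]
  exact h.mul_mgfDeriv_lt_one hu

lemma tiltParam_pos : 0 < tiltParam μ a Y c := by
  have := h.tiltParam_strictMonoOn (Set.mem_Iic.2 h.tilt_pos.le) (Set.mem_Iic.2 le_rfl) h.tilt_pos
  rwa [tiltParam_zero] at this

lemma exists_tiltParam_eq {θ : ℝ} (hθ : θ ≤ tiltParam μ a Y c) :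
    ∃ u ≤ c, tiltParam μ a Y u = θ := by
  have hlim : Tendsto (tiltParam μ a Y) atBot atBot := by
    refine tendsto_atBot_mono (fun u => (?_ : tiltParam μ a Y u ≤ u + a))
      (tendsto_atBot_add_const_right _ a tendsto_id)
    have := mul_nonneg h.coeff_pos.le (mgf_nonneg (X := Y) (μ := μ) (t := u))
    rw [tiltParam]
    linarith
  exact isPreconnected_Iic.intermediate_value_Iic (Set.mem_Iic.2 le_rfl)
    (le_principal_iff.2 (Iic_mem_atBot c)) h.tiltParam_continuousOn hlim hθ

omit [IsProbabilityMeasure μ] in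
/-- Every positive slope is attained by `ν E[exp (u Y)]` as a function of `tiltParam`, for a `u`
below the critical parameter. -/
lemma exists_mgfDeriv_eq {ν x : ℝ} (hν : 0 < ν) (hx : 0 < x) :
    ∃ u < c, ν * mgfDeriv Y μ u = x * (1 - a * mgfDeriv Y μ u) := by
  have ha := h.coeff_pos
  have hd : 0 < ν + a * x := by positivity
  have hcr : mgfDeriv Y μ c = 1 / a := by rw [eq_div_iff ha.ne', mul_comm]; exact h.critical
  have hlt : x / (ν + a * x) < 1 / a := by
    rw [div_lt_div_iff₀ hd ha]
    linarith
  obtain ⟨u, hu, hu'⟩ := isPreconnected_Iic.intermediate_value_Ioc (Set.mem_Iic.2 (le_refl c))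
    (le_principal_iff.2 (Iic_mem_atBot c))
    (mgfDeriv_continuousOn h.integrable.aemeasurable h.pos h.integrable_mul_exp)
    (tendsto_mgfDeriv_atBot h.integrable h.pos) (show x / (ν + a * x) ∈ _ from
      ⟨by positivity, by rw [hcr]; exact hlt.le⟩)
  refine ⟨u, lt_of_le_of_ne hu fun hcu => ?_, ?_⟩
  · rw [hcu, hcr] at hu'
    exact hlt.ne' hu'
  · rw [hu']
    field_simp
    ring

/-- The derivative of `Γ` at `tiltParam u` is `x`, by the chain rule along the parametrization. -/
lemma exposedAt {ν x : ℝ} {Γ : ℝ → ℝ}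
    (hΓ : ∀ v ≤ c, Γ (tiltParam μ a Y v) = ν * (mgf Y μ v - 1)) (hu : u < c)
    (hx : ν * mgfDeriv Y μ u = x * (1 - a * mgfDeriv Y μ u)) :
    ExposedAt Γ (tiltParam μ a Y c) (tiltParam μ a Y u) x := by
  intro δ hδ
  have hpos : 0 < 1 - a * mgfDeriv Y μ u := sub_pos.2 (h.mul_mgfDeriv_lt_one hu)
  have hder : ∀ s : ℝ, HasDerivAt (fun v => ν * mgf Y μ v - s * tiltParam μ a Y v)
      (ν * mgfDeriv Y μ u - s * (1 - a * mgfDeriv Y μ u)) u := fun s =>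
    ((h.hasDerivAt_mgf hu).const_mul ν).sub ((h.hasDerivAt_tiltParam hu).const_mul s)
  constructor
  · have hneg : ν * mgfDeriv Y μ u - (x + δ) * (1 - a * mgfDeriv Y μ u) < 0 := by
      rw [hx]
      nlinarith
    have h1 := (hasDerivAt_iff_tendsto_slope.1 (hder (x + δ))).eventually_lt_const hneg
    have h2 := h1.filter_mono (nhdsWithin_mono u (show Set.Ioi u ⊆ {u}ᶜ from
      fun v hv => (Set.mem_Ioi.1 hv).ne'))
    obtain ⟨v, h3, huv, hvc⟩ := (h2.and (eventually_mem_nhdsWithin.and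
      (eventually_nhdsWithin_of_eventually_nhds (eventually_lt_nhds hu)))).exists
    have huv : u < v := huv
    rw [slope_def_field, div_lt_iff₀ (sub_pos.2 huv), zero_mul] at h3
    have hmono := h.tiltParam_strictMonoOn hu.le hvc.le huv
    refine ⟨tiltParam μ a Y v - tiltParam μ a Y u, sub_pos.2 hmono, ?_, ?_⟩
    · rw [add_sub_cancel]
      exact h.tiltParam_strictMonoOn.monotoneOn hvc.le (Set.mem_Iic.2 le_rfl) hvc.le
    · rw [add_sub_cancel, hΓ v hvc.le, hΓ u hu.le]
      linarith
  · have hneg : 0 < ν * mgfDeriv Y μ u - (x - δ) * (1 - a * mgfDeriv Y μ u) := by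
      rw [hx]
      nlinarith
    have h1 := (hasDerivAt_iff_tendsto_slope.1 (hder (x - δ))).eventually_const_lt hneg
    have h2 := h1.filter_mono (nhdsWithin_mono u (show Set.Iio u ⊆ {u}ᶜ from
      fun v hv => (Set.mem_Iio.1 hv).ne))
    obtain ⟨v, h3, huv⟩ := (h2.and self_mem_nhdsWithin).exists
    have huv : v < u := huv
    rw [slope_def_field, lt_div_iff_of_neg (sub_neg.2 huv), zero_mul] at h3
    have hmono := h.tiltParam_strictMonoOn (huv.trans hu).le hu.le huv
    refine ⟨tiltParam μ a Y u - tiltParam μ a Y v, sub_pos.2 hmono, ?_⟩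
    rw [sub_sub_cancel, hΓ v (huv.trans hu).le, hΓ u hu.le]
    linarith

end IsCriticalTilt

end Mark

/-! ### Exponential moments of the marked Hawkes process -/

namespace MarkedHawkes

open scoped ENNReal

variable {Ω : Type*} {Z : ℕ → Ω → ℕ} {ℓ : ℕ → ℕ → Ω → ℝ} {ν : ℝ} {α : ℕ → ℝ} {c θ : ℝ}

lemma measurable_X_past {s t : ℕ} (hs : s ∈ Finset.Ico 1 t) :
    Measurable[past Z ℓ t] (X Z ℓ s) := by
  have h : MeasurableSpace.comap (X Z ℓ s) inferInstance ≤ past Z ℓ t :=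
    le_iSup₂_of_le s hs le_rfl
  exact Measurable.of_comap_le h

lemma measurable_intensity_past (t : ℕ) : Measurable[past Z ℓ t] (intensity ν α Z ℓ t) := by
  refine measurable_const.add (Finset.measurable_sum _ fun s hs => ?_)
  refine Measurable.const_mul (measurable_X_past (Finset.mem_Ico.2 ?_)) _
  have := Finset.mem_Ico.1 hs
  omega

lemma measurable_sum_marksAt (t k : ℕ) :
    Measurable[marksAt ℓ t] (fun ω => ∑ j ∈ Finset.Icc 1 k, ℓ t j ω) := by
  refine Finset.measurable_sum _ fun j hj => ?_
  obtain ⟨i, rfl⟩ : ∃ i, j = i + 1 := ⟨j - 1, by have := Finset.mem_Icc.1 hj; omega⟩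
  have h : MeasurableSpace.comap (ℓ t (i + 1)) inferInstance ≤ marksAt ℓ t :=
    le_iSup_of_le i le_rfl
  exact Measurable.of_comap_le h

lemma intensity_eq (n : ℕ) (ω : Ω) :
    intensity ν α Z ℓ (n + 1) ω = ν + ∑ s ∈ Finset.Icc 1 n, α (n + 1 - s) * X Z ℓ s ω := by
  have h := Finset.sum_Ico_reflect (fun s => α s * X Z ℓ (n + 1 - s) ω) 1
    (show n + 1 ≤ n + 1 + 1 by omega)
  simp only [show n + 1 + 1 - (n + 1) = 1 by omega, show n + 1 + 1 - 1 = n + 1 by omega] at h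
  rw [intensity, ← h, show Finset.Icc 1 n = Finset.Ico 1 (n + 1) from rfl]
  congr 1
  refine Finset.sum_congr rfl fun s hs => ?_
  have := Finset.mem_Ico.1 hs
  rw [show n + 1 - (n + 1 - s) = s by omega]

variable [mΩ : MeasurableSpace Ω] {μ : Measure Ω} [IsProbabilityMeasure μ]

namespace IsMarkedHawkes

variable (hH : IsMarkedHawkes μ ν α Z ℓ)

include hH

omit [IsProbabilityMeasure μ] in
lemma measurable_X (t : ℕ) : Measurable (X Z ℓ t) := by
  rcases Nat.eq_zero_or_pos t with rfl | ht
  · have h : X Z ℓ 0 = fun _ => 0 := by ext; simp [X]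
    rw [h]
    exact measurable_const
  · have h : Measurable (fun p : ℕ × Ω => ∑ j ∈ Finset.Icc 1 p.1, ℓ t j p.2) :=
      measurable_from_prod_countable_right fun k => Finset.measurable_sum _ fun j hj =>
        hH.measurable_mark t j ht (Finset.mem_Icc.1 hj).1
    have h2 := h.comp ((hH.measurable_count t ht).prodMk measurable_id)
    convert h2 using 1
    ext ω
    simp [X, ht.ne']

omit [IsProbabilityMeasure μ] in
lemma past_le (t : ℕ) : past Z ℓ t ≤ mΩ :=
  iSup₂_le fun s _ => (hH.measurable_X s).comap_le

omit [IsProbabilityMeasure μ] in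
lemma marksAt_le {t : ℕ} (ht : 1 ≤ t) : marksAt ℓ t ≤ mΩ :=
  iSup_le fun j => (hH.measurable_mark t (j + 1) ht (by omega)).comap_le

omit [IsProbabilityMeasure μ] in
lemma X_nonneg (t : ℕ) : ∀ᵐ ω ∂μ, 0 ≤ X Z ℓ t ω := by
  rcases Nat.eq_zero_or_pos t with rfl | ht
  · simp [X]
  · have h : ∀ᵐ ω ∂μ, ∀ j, 1 ≤ j → 0 < ℓ t j ω :=
      ae_all_iff.2 fun j => eventually_imp_distrib_left.2 (hH.mark_pos t j ht)
    filter_upwards [h] with ω hω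
    rw [X, if_neg ht.ne']
    exact Finset.sum_nonneg fun j hj => (hω j (Finset.mem_Icc.1 hj).1).le

omit [IsProbabilityMeasure μ] in
lemma intensity_nonneg (hν : 0 < ν) (hα : ∀ t, 1 ≤ t → 0 ≤ α t) (t : ℕ) :
    ∀ᵐ ω ∂μ, 0 ≤ intensity ν α Z ℓ t ω := by
  filter_upwards [ae_all_iff.2 hH.X_nonneg] with ω hω
  exact add_nonneg hν.le (Finset.sum_nonneg fun s hs =>
    mul_nonneg (hα s (Finset.mem_Ico.1 hs).1) (hω _))

/-- Integration of a past-measurable function over `{Z t = k}`, by the conditional Poisson law. -/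
lemma setLIntegral_count_eq (hν : 0 < ν) (hα : ∀ t, 1 ≤ t → 0 ≤ α t) {t : ℕ} (ht : 1 ≤ t) (k : ℕ)
    {G : Ω → ℝ≥0∞} (hG : Measurable[past Z ℓ t] G) :
    ∫⁻ ω in {ω | Z t ω = k}, G ω ∂μ =
      ∫⁻ ω, ENNReal.ofReal (Real.exp (-intensity ν α Z ℓ t ω) * intensity ν α Z ℓ t ω ^ k /
        (k.factorial : ℝ)) * G ω ∂μ := by
  set p : Ω → ℝ := fun ω => Real.exp (-intensity ν α Z ℓ t ω) * intensity ν α Z ℓ t ω ^ k /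
    (k.factorial : ℝ) with hp
  have hm := hH.past_le t
  have hZk : MeasurableSet {ω | Z t ω = k} := hH.measurable_count t ht (measurableSet_singleton k)
  have hcond := hH.count_poisson t ht k
  have hpm : Measurable p := by
    have := (measurable_intensity_past (ν := ν) (α := α) (Z := Z) (ℓ := ℓ) t).mono hm le_rfl
    fun_prop
  have hp0 : ∀ᵐ ω ∂μ, 0 ≤ p ω := by
    filter_upwards [hH.intensity_nonneg hν hα t] with ω hω
    positivity
  have hpi : Integrable p μ := integrable_condExp.congr hcond
  have hmeas : (μ.restrict {ω | Z t ω = k}).trim hm =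
      (μ.withDensity fun ω => ENNReal.ofReal (p ω)).trim hm := by
    refine @Measure.ext _ (past Z ℓ t) _ _ fun S hS => ?_
    rw [trim_measurableSet_eq hm hS, trim_measurableSet_eq hm hS,
      Measure.restrict_apply (hm S hS), withDensity_apply _ (hm S hS),
      ← ofReal_integral_eq_lintegral_ofReal hpi.integrableOn (ae_restrict_of_ae hp0),
      ← setIntegral_congr_ae (hm S hS) (hcond.mono fun ω h _ => h),
      setIntegral_condExp hm ((integrable_const _).indicator hZk) hS,
      setIntegral_indicator hZk, setIntegral_const, smul_eq_mul, mul_one, ofReal_measureReal]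
  rw [← lintegral_trim hm hG, hmeas, lintegral_trim hm hG,
    lintegral_withDensity_eq_lintegral_mul _ hpm.ennreal_ofReal (hG.mono hm le_rfl)]
  rfl

lemma lintegral_exp_sum_marks {t : ℕ} (ht : 1 ≤ t)
    (hc : Integrable (fun ω => Real.exp (c * ℓ 1 1 ω)) μ) (k : ℕ) :
    ∫⁻ ω, ENNReal.ofReal (Real.exp (c * ∑ j ∈ Finset.Icc 1 k, ℓ t j ω)) ∂μ =
      ENNReal.ofReal (mgf (ℓ 1 1) μ c ^ k) := by
  have hind : iIndepFun (fun j : ℕ => ℓ t (j + 1)) μ := by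
    obtain ⟨s, rfl⟩ : ∃ s, t = s + 1 := ⟨t - 1, by omega⟩
    exact hH.mark_indep.precomp (g := fun j : ℕ => (s, j)) fun i j hij => (Prod.mk.inj hij).2
  have hm : ∀ j : ℕ, Measurable (ℓ t (j + 1)) := fun j => hH.measurable_mark t _ ht (by omega)
  have hint : ∀ j : ℕ, Integrable (fun ω => Real.exp (c * ℓ t (j + 1) ω)) μ := fun j =>
    ((hH.mark_ident t (j + 1) ht (by omega)).comp (u := fun x => Real.exp (c * x))
      (by fun_prop)).integrable_iff.2 hc
  have hsum : ∀ ω, ∑ j ∈ Finset.Icc 1 k, ℓ t j ω =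
      (∑ j ∈ Finset.range k, fun ω => ℓ t (j + 1) ω) ω := fun ω => by
    rw [Finset.sum_apply, Finset.range_eq_Ico, Finset.sum_Ico_add' (fun j => ℓ t j ω) 0 k 1]
    rfl
  simp only [hsum]
  rw [← ofReal_integral_eq_lintegral_ofReal
    (hind.integrable_exp_mul_sum hm fun j _ => hint j) (ae_of_all _ fun _ => (Real.exp_pos _).le)]
  congr 1
  have h1 := hind.mgf_sum (t := c) hm (Finset.range k)
  rw [Finset.prod_congr rfl fun j _ =>
    mgf_congr_of_identDistrib _ _ (hH.mark_ident t (j + 1) ht (by omega)) c,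
    Finset.prod_const, Finset.card_range] at h1
  exact h1

/-- Conditionally on the past, `X t` is compound Poisson with intensity `λ t`. -/
lemma lintegral_mul_exp_X (hν : 0 < ν) (hα : ∀ t, 1 ≤ t → 0 ≤ α t) {t : ℕ} (ht : 1 ≤ t)
    (hc : Integrable (fun ω => Real.exp (c * ℓ 1 1 ω)) μ)
    {G : Ω → ℝ≥0∞} (hG : Measurable[past Z ℓ t] G) :
    ∫⁻ ω, G ω * ENNReal.ofReal (Real.exp (c * X Z ℓ t ω)) ∂μ =
      ∫⁻ ω, G ω * ENNReal.ofReal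
        (Real.exp (intensity ν α Z ℓ t ω * (mgf (ℓ 1 1) μ c - 1))) ∂μ := by
  have hm := hH.past_le t
  have hZ := hH.measurable_count t ht
  have hZk : ∀ k : ℕ, MeasurableSet {ω | Z t ω = k} := fun k => hZ (measurableSet_singleton k)
  have hGm : Measurable G := hG.mono hm le_rfl
  have hIm : Measurable (intensity ν α Z ℓ t) := (measurable_intensity_past t).mono hm le_rfl
  have hmgf : 0 ≤ mgf (ℓ 1 1) μ c := mgf_nonneg
  have hU : (⋃ k : ℕ, {ω | Z t ω = k}) = Set.univ := Set.eq_univ_of_forall fun ω =>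
    Set.mem_iUnion.2 ⟨Z t ω, rfl⟩
  have hdisj : Pairwise (Function.onFun Disjoint fun k : ℕ => {ω | Z t ω = k}) := fun i j hij =>
    Set.disjoint_left.2 fun ω (hi : Z t ω = i) (hj : Z t ω = j) => hij (hi.symm.trans hj)
  have hpiece : ∀ k : ℕ, ∫⁻ ω in {ω | Z t ω = k},
      G ω * ENNReal.ofReal (Real.exp (c * X Z ℓ t ω)) ∂μ =
      ∫⁻ ω, ENNReal.ofReal (Real.exp (-intensity ν α Z ℓ t ω) * intensity ν α Z ℓ t ω ^ k /
        (k.factorial : ℝ)) * G ω * ENNReal.ofReal (mgf (ℓ 1 1) μ c ^ k) ∂μ := by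
    intro k
    have h1 : ∫⁻ ω in {ω | Z t ω = k}, G ω * ENNReal.ofReal (Real.exp (c * X Z ℓ t ω)) ∂μ =
        ∫⁻ ω, ENNReal.ofReal (Real.exp (c * ∑ j ∈ Finset.Icc 1 k, ℓ t j ω)) *
          {ω | Z t ω = k}.indicator G ω ∂μ := by
      rw [← lintegral_indicator (hZk k)]
      refine lintegral_congr fun ω => ?_
      by_cases hω : Z t ω = k
      · rw [Set.indicator_of_mem (by exact hω), Set.indicator_of_mem (by exact hω), X,
          if_neg (by omega), hω, mul_comm]
      · rw [Set.indicator_of_notMem (by exact hω), Set.indicator_of_notMem (by exact hω), mul_zero]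
    have hle : past Z ℓ t ⊔ MeasurableSpace.comap (Z t) inferInstance ≤ mΩ :=
      sup_le hm hZ.comap_le
    have hGk : Measurable[past Z ℓ t ⊔ MeasurableSpace.comap (Z t) inferInstance]
        ({ω | Z t ω = k}.indicator G) := by
      refine Measurable.indicator (hG.mono le_sup_left le_rfl) ?_
      exact (le_sup_right : MeasurableSpace.comap (Z t) inferInstance ≤ _) _
        ⟨{k}, measurableSet_singleton k, rfl⟩
    rw [h1, lintegral_mul_eq_lintegral_mul_lintegral_of_independent_measurableSpace
      (hH.marksAt_le ht) hle (hH.mark_indep_past t ht)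
      (((measurable_sum_marksAt t k).const_mul c).exp.ennreal_ofReal) hGk,
      hH.lintegral_exp_sum_marks ht hc, lintegral_indicator (hZk k),
      hH.setLIntegral_count_eq hν hα ht k hG, mul_comm, lintegral_mul_const]
    fun_prop
  rw [← setLIntegral_univ, ← hU, lintegral_iUnion hZk hdisj]
  simp_rw [hpiece]
  rw [← lintegral_tsum fun k => by fun_prop]
  refine lintegral_congr_ae ?_
  filter_upwards [hH.intensity_nonneg hν hα t] with ω hω
  set lam := intensity ν α Z ℓ t ω
  have hs : HasSum (fun k : ℕ => Real.exp (-lam) * ((lam * mgf (ℓ 1 1) μ c) ^ k /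
      (k.factorial : ℝ))) (Real.exp (-lam) * Real.exp (lam * mgf (ℓ 1 1) μ c)) := by
    have he := NormedSpace.expSeries_div_hasSum_exp (lam * mgf (ℓ 1 1) μ c)
    rw [← Real.exp_eq_exp_ℝ] at he
    exact he.mul_left _
  rw [mul_sub, mul_one, sub_eq_neg_add, Real.exp_add, ← hs.tsum_eq,
    ENNReal.ofReal_tsum_of_nonneg (fun k => by positivity) hs.summable, ← ENNReal.tsum_mul_left]
  refine tsum_congr fun k => ?_
  rw [mul_comm _ (G ω), mul_assoc, ← ENNReal.ofReal_mul (by positivity)]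
  congr 2
  ring

/-- Integrating out the last step: the coefficient `c (n + 1)` of `X (n + 1)` is fed back to the
earlier coefficients through the intensity. -/
lemma lintegral_exp_sum_succ (hν : 0 < ν) (hα : ∀ t, 1 ≤ t → 0 ≤ α t) (n : ℕ) (c : ℕ → ℝ)
    (hc : Integrable (fun ω => Real.exp (c (n + 1) * ℓ 1 1 ω)) μ) :
    ∫⁻ ω, ENNReal.ofReal (Real.exp (∑ s ∈ Finset.Icc 1 (n + 1), c s * X Z ℓ s ω)) ∂μ =
      ENNReal.ofReal (Real.exp (ν * (mgf (ℓ 1 1) μ (c (n + 1)) - 1))) *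
        ∫⁻ ω, ENNReal.ofReal (Real.exp (∑ s ∈ Finset.Icc 1 n,
          (c s + α (n + 1 - s) * (mgf (ℓ 1 1) μ (c (n + 1)) - 1)) * X Z ℓ s ω)) ∂μ := by
  have hG : Measurable[past Z ℓ (n + 1)]
      (fun ω => ENNReal.ofReal (Real.exp (∑ s ∈ Finset.Icc 1 n, c s * X Z ℓ s ω))) := by
    refine Measurable.ennreal_ofReal (Measurable.exp (Finset.measurable_sum _ fun s hs => ?_))
    exact Measurable.const_mul (measurable_X_past (by simpa [Nat.lt_succ_iff] using hs)) _
  have h1 := hH.lintegral_mul_exp_X hν hα (show 1 ≤ n + 1 by omega) hc hG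
  have hX := hH.measurable_X
  rw [← lintegral_const_mul _ (by fun_prop)]
  calc _ = _ := lintegral_congr fun ω => ?_
    _ = _ := h1
    _ = _ := lintegral_congr fun ω => ?_
  · rw [Finset.sum_Icc_succ_top (by omega), Real.exp_add, ENNReal.ofReal_mul (Real.exp_pos _).le]
  · rw [← ENNReal.ofReal_mul (Real.exp_pos _).le, ← ENNReal.ofReal_mul (Real.exp_pos _).le,
      ← Real.exp_add, ← Real.exp_add, intensity_eq, add_mul, Finset.sum_mul, add_left_comm,
      ← Finset.sum_add_distrib]
    congr 3
    refine Finset.sum_congr rfl fun s _ => ?_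
    ring

/-- The exponential moment of `L t` after `k` steps of backward integration. -/
lemma lintegral_exp_L_step (hν : 0 < ν) (hα : ∀ t, 1 ≤ t → 0 ≤ α t)
    (hf : ∀ k, Integrable (fun ω => Real.exp
      (renewalSeq α (fun x => mgf (ℓ 1 1) μ x - 1) θ k * ℓ 1 1 ω)) μ) (t k : ℕ) (hk : k ≤ t) :
    ∫⁻ ω, ENNReal.ofReal (Real.exp (θ * L Z ℓ t ω)) ∂μ =
      ENNReal.ofReal (Real.exp (ν * ∑ i ∈ Finset.range k,
        (mgf (ℓ 1 1) μ (renewalSeq α (fun x => mgf (ℓ 1 1) μ x - 1) θ i) - 1))) *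
      ∫⁻ ω, ENNReal.ofReal (Real.exp (∑ s ∈ Finset.Icc 1 (t - k),
        (θ + ∑ i ∈ Finset.range k, α (t - i - s) *
          (mgf (ℓ 1 1) μ (renewalSeq α (fun x => mgf (ℓ 1 1) μ x - 1) θ i) - 1)) *
            X Z ℓ s ω)) ∂μ := by
  set f := renewalSeq α (fun x => mgf (ℓ 1 1) μ x - 1) θ with hfdef
  induction k with
  | zero => simp [L, Finset.mul_sum]
  | succ k ih =>
    rw [ih (by omega)]
    obtain ⟨n, hn⟩ : ∃ n, t - k = n + 1 := ⟨t - k - 1, by omega⟩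
    have hfk : θ + ∑ i ∈ Finset.range k, α (t - i - (n + 1)) * (mgf (ℓ 1 1) μ (f i) - 1) = f k := by
      rw [hfdef, renewalSeq_eq k, ← hfdef]
      congr 1
      refine Finset.sum_congr rfl fun i hi => ?_
      rw [show t - i - (n + 1) = k - i by omega]
    have h1 := hH.lintegral_exp_sum_succ hν hα n
      (fun s => θ + ∑ i ∈ Finset.range k, α (t - i - s) * (mgf (ℓ 1 1) μ (f i) - 1))
      (by simp only [hfk]; exact hf k)
    simp only [hfk] at h1
    rw [hn, h1, ← mul_assoc, ← ENNReal.ofReal_mul (Real.exp_pos _).le, ← Real.exp_add, ← mul_add,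
      ← Finset.sum_range_succ, show t - (k + 1) = n by omega]
    congr 1
    refine lintegral_congr fun ω => ?_
    congr 2
    refine Finset.sum_congr rfl fun s hs => ?_
    have := Finset.mem_Icc.1 hs
    rw [Finset.sum_range_succ, show t - k - s = n + 1 - s by omega, add_assoc]

/-- `log E[exp (θ L t)] = ν ∑_{k < t} (E[exp (f k ℓ)] - 1)`, where `f` solves the renewal
recursion started from `θ`. -/
lemma integrable_exp_L_and_integral_eq (hν : 0 < ν) (hα : ∀ t, 1 ≤ t → 0 ≤ α t)
    (hf : ∀ k, Integrable (fun ω => Real.exp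
      (renewalSeq α (fun x => mgf (ℓ 1 1) μ x - 1) θ k * ℓ 1 1 ω)) μ) (t : ℕ) :
    Integrable (fun ω => Real.exp (θ * L Z ℓ t ω)) μ ∧
      ∫ ω, Real.exp (θ * L Z ℓ t ω) ∂μ = Real.exp (ν * ∑ i ∈ Finset.range t,
        (mgf (ℓ 1 1) μ (renewalSeq α (fun x => mgf (ℓ 1 1) μ x - 1) θ i) - 1)) := by
  have h := hH.lintegral_exp_L_step hν hα hf t t le_rfl
  simp only [Nat.sub_self, Finset.Icc_eq_empty (show ¬(1 ≤ 0) by omega), Finset.sum_empty,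
    Real.exp_zero, ENNReal.ofReal_one, lintegral_const, measure_univ, mul_one] at h
  have hm : AEStronglyMeasurable (fun ω => Real.exp (θ * L Z ℓ t ω)) μ := by
    have : Measurable (L Z ℓ t) := Finset.measurable_sum _ fun s _ => hH.measurable_X s
    fun_prop
  have h0 : 0 ≤ᵐ[μ] fun ω => Real.exp (θ * L Z ℓ t ω) := ae_of_all _ fun _ => (Real.exp_pos _).le
  refine ⟨(lintegral_ofReal_ne_top_iff_integrable hm h0).1 (h ▸ ENNReal.ofReal_ne_top), ?_⟩
  rw [integral_eq_lintegral_of_nonneg_ae h0 hm, h, ENNReal.toReal_ofReal (Real.exp_pos _).le]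

end IsMarkedHawkes

end MarkedHawkes

/-! ### The critical pair and the minimal solution -/

namespace MarkedHawkes

variable {Ω : Type*} [MeasurableSpace Ω] {μ : Measure Ω} {Y : Ω → ℝ} {a c u ν θ x : ℝ}

lemma mem_solutions_iff :
    x ∈ solutions μ a Y θ ↔
      Integrable (fun ω => Real.exp ((θ + a * (x - 1)) * Y ω)) μ ∧
        x = mgf Y μ (θ + a * (x - 1)) := by
  have h : ∀ ω, θ * Y ω + a * Y ω * (x - 1) = (θ + a * (x - 1)) * Y ω := fun ω => by ring
  simp only [solutions, Set.mem_ofPred_eq, h, mgf]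

lemma IsTangency.isCriticalTilt {θc xc : ℝ} (hT : IsTangency μ a Y θc xc) (hint : Integrable Y μ)
    (hpos : ∀ᵐ ω ∂μ, 0 < Y ω) (ha : 0 < a) (hsub : a * ∫ ω, Y ω ∂μ < 1) :
    IsCriticalTilt μ a Y (θc + a * (xc - 1)) := by
  have h : ∀ ω, a * Y ω * Real.exp (θc * Y ω + a * Y ω * (xc - 1)) =
      a * (Y ω * Real.exp ((θc + a * (xc - 1)) * Y ω)) := fun ω => by
    rw [mul_assoc, show θc * Y ω + a * Y ω * (xc - 1) = (θc + a * (xc - 1)) * Y ω by ring]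
  obtain ⟨h1, h2, h3⟩ := hT
  simp only [h] at h2 h3
  rw [integral_const_mul] at h3
  exact ⟨hpos, hint, ha, hsub, (mem_solutions_iff.1 h1).1,
    (integrable_const_mul_iff ha.ne'.isUnit _).1 h2, h3⟩

lemma IsTangency.mgf_eq {θc xc : ℝ} (hT : IsTangency μ a Y θc xc) :
    mgf Y μ (θc + a * (xc - 1)) = xc :=
  (mem_solutions_iff.1 hT.1).2.symm

lemma IsTangency.tiltParam_eq {θc xc : ℝ} (hT : IsTangency μ a Y θc xc) :
    tiltParam μ a Y (θc + a * (xc - 1)) = θc := by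
  rw [tiltParam, hT.mgf_eq]
  ring

lemma isTangency_of_isCriticalTilt (h : IsCriticalTilt μ a Y c) :
    IsTangency μ a Y (tiltParam μ a Y c) (mgf Y μ c) := by
  have h0 : tiltParam μ a Y c + a * (mgf Y μ c - 1) = c := by rw [tiltParam]; ring
  have h1 : ∀ ω, a * Y ω * Real.exp (tiltParam μ a Y c * Y ω + a * Y ω * (mgf Y μ c - 1)) =
      a * (Y ω * Real.exp (c * Y ω)) := fun ω => by
    rw [mul_assoc, show tiltParam μ a Y c * Y ω + a * Y ω * (mgf Y μ c - 1) =
      (tiltParam μ a Y c + a * (mgf Y μ c - 1)) * Y ω by ring, h0]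
  refine ⟨mem_solutions_iff.2 (by rw [h0]; exact ⟨h.integrable_exp, rfl⟩), ?_, ?_⟩
  · simp only [h1]
    exact h.integrable_mul_exp.const_mul a
  · simp only [h1]
    rw [integral_const_mul]
    exact h.critical

variable [IsProbabilityMeasure μ]

/-- A solution `x` for `θ` corresponds to `u = θ + a (x - 1)` with `tiltParam u = θ`; on the
increasing branch of `tiltParam` lies the smallest one. -/
lemma isLeast_solutions (h : IsCriticalTilt μ a Y c) (hu : u ≤ c) :
    IsLeast (solutions μ a Y (tiltParam μ a Y u)) (mgf Y μ u) := by
  have h0 : tiltParam μ a Y u + a * (mgf Y μ u - 1) = u := by rw [tiltParam]; ring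
  refine ⟨mem_solutions_iff.2 (by rw [h0]; exact ⟨h.integrable_exp_of_le hu, rfl⟩),
    fun x hx => ?_⟩
  obtain ⟨-, h2⟩ := mem_solutions_iff.1 hx
  set w := tiltParam μ a Y u + a * (x - 1) with hw
  have hψ : tiltParam μ a Y w = tiltParam μ a Y u := by
    rw [tiltParam, ← h2, hw]
    ring
  have huw : u ≤ w := by
    by_contra! hlt
    exact (h.tiltParam_strictMonoOn (Set.mem_Iic.2 (hlt.le.trans hu)) hu hlt).ne hψ
  have h3 : a * mgf Y μ u ≤ a * x := by linarith
  exact le_of_mul_le_mul_left h3 h.coeff_pos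

lemma GammaL_tiltParam (h : IsCriticalTilt μ a Y c) (hu : u ≤ c) :
    GammaL μ ν a Y (tiltParam μ a Y u) = ν * (mgf Y μ u - 1) := by
  rw [GammaL, gL, (isLeast_solutions h hu).csInf_eq]

lemma GammaL_zero (h : IsCriticalTilt μ a Y c) : GammaL μ ν a Y 0 = 0 := by
  have h0 := GammaL_tiltParam (ν := ν) h h.tilt_pos.le
  rwa [IsCriticalTilt.tiltParam_zero, mgf_zero, sub_self, mul_zero] at h0

lemma GammaL_nonpos (h : IsCriticalTilt μ a Y c) (hν : 0 < ν) (hθ : θ ≤ 0) :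
    GammaL μ ν a Y θ ≤ 0 := by
  obtain ⟨u, hu, rfl⟩ := h.exists_tiltParam_eq (hθ.trans h.tiltParam_pos.le)
  have hu0 : u ≤ 0 := by
    by_contra! hlt
    have := h.tiltParam_strictMonoOn (Set.mem_Iic.2 h.tilt_pos.le) hu hlt
    rw [IsCriticalTilt.tiltParam_zero] at this
    linarith
  rw [GammaL_tiltParam h hu]
  have h1 := h.mgf_monotoneOn hu (Set.mem_Iic.2 h.tilt_pos.le) hu0
  rw [mgf_zero] at h1
  exact mul_nonpos_of_nonneg_of_nonpos hν.le (by linarith)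

/-- The rate is infinite on the negative half-line, as `Γ θ ≤ 0` for `θ ≤ 0`. -/
lemma rateL_of_neg (h : IsCriticalTilt μ a Y c) (hν : 0 < ν) (hx : x < 0) :
    rateL μ ν a Y (tiltParam μ a Y c) x = ⊤ := by
  refine EReal.eq_top_iff_forall_lt _ |>.2 fun r => ?_
  have hθ : -((|r| + 1) / -x) ≤ 0 := neg_nonpos.2 (by have := neg_pos.2 hx; positivity)
  refine lt_of_lt_of_le ?_ (le_iSup₂_of_le (-((|r| + 1) / -x))
    (Set.mem_Iic.2 (hθ.trans h.tiltParam_pos.le)) le_rfl)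
  rw [EReal.coe_lt_coe_iff]
  have h1 := GammaL_nonpos h hν hθ
  have h2 : -((|r| + 1) / -x) * x = |r| + 1 := by
    have := hx.ne
    field_simp
  rw [h2]
  linarith [le_abs_self r]

lemma rateL_nonneg (h : IsCriticalTilt μ a Y c) (x : ℝ) :
    0 ≤ rateL μ ν a Y (tiltParam μ a Y c) x := by
  refine le_iSup₂_of_le 0 (Set.mem_Iic.2 h.tiltParam_pos.le) ?_
  rw [GammaL_zero h]
  simp

omit [IsProbabilityMeasure μ] in
lemma rateL_lowerSemicontinuous (θc : ℝ) : LowerSemicontinuous (rateL μ ν a Y θc) :=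
  lowerSemicontinuous_biSup fun θ _ =>
    (continuous_coe_real_ereal.comp
      (by fun_prop : Continuous fun x : ℝ => θ * x - GammaL μ ν a Y θ)).lowerSemicontinuous

/-- Arbitrarily small positive points are exposed at some `θ ≤ 0`. -/
lemma exists_exposedAt_small (h : IsCriticalTilt μ a Y c) (hν : 0 < ν) {η : ℝ} (hη : 0 < η) :
    ∃ θ ≤ 0, ∃ x, 0 < x ∧ x < η ∧
      ExposedAt (GammaL μ ν a Y) (tiltParam μ a Y c) θ x := by
  have hlim : Tendsto (fun u => ν * mgfDeriv Y μ u / (1 - a * mgfDeriv Y μ u)) atBot (𝓝 0) := by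
    have h1 := tendsto_mgfDeriv_atBot h.integrable h.pos
    have h2 : Tendsto (fun u => ν * mgfDeriv Y μ u / (1 - a * mgfDeriv Y μ u)) atBot
        (𝓝 (ν * 0 / (1 - a * 0))) :=
      (h1.const_mul ν).div ((h1.const_mul a).const_sub 1) (by simp)
    simpa using h2
  obtain ⟨u, hu1, hu0⟩ := ((hlim.eventually_lt_const hη).and (eventually_lt_atBot 0)).exists
  have huc : u < c := hu0.trans h.tilt_pos
  have hd : 0 < 1 - a * mgfDeriv Y μ u := sub_pos.2 (h.mul_mgfDeriv_lt_one huc)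
  have hm : 0 < mgfDeriv Y μ u := integral_pos_of_ae_pos
    (integrable_mul_exp_mul_of_le_of_pos h.integrable.aemeasurable h.pos h.integrable_mul_exp
      huc.le) (h.pos.mono fun ω hω => mul_pos hω (Real.exp_pos _))
  refine ⟨tiltParam μ a Y u, ?_, _, by positivity, hu1,
    h.exposedAt (fun v hv => GammaL_tiltParam h hv) huc (div_mul_cancel₀ _ hd.ne').symm⟩
  have := h.tiltParam_strictMonoOn huc.le (Set.mem_Iic.2 h.tilt_pos.le) hu0
  rw [IsCriticalTilt.tiltParam_zero] at this
  exact this.le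

/-! ### The large deviation principle -/

/-- The large deviation principle, from the exact exponential moments and the exposed points. -/
lemma satisfiesLDP_L {Z : ℕ → Ω → ℕ} {ℓ : ℕ → ℕ → Ω → ℝ} {α : ℕ → ℝ}
    (hν : 0 < ν) (hα : ∀ t, 1 ≤ t → 0 ≤ α t) (hsum : Summable fun t : ℕ => α (t + 1))
    (hH : IsMarkedHawkes μ ν α Z ℓ) (h : IsCriticalTilt μ (norm1 α) (ℓ 1 1) c) :
    SatisfiesLDP (fun t : ℕ => μ.map (fun ω => L Z ℓ t ω / (t : ℝ))) (fun t : ℕ => (t : ℝ))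
      (rateL μ ν (norm1 α) (ℓ 1 1) (tiltParam μ (norm1 α) (ℓ 1 1) c)) := by
  set H : ℝ → ℝ := fun x => mgf (ℓ 1 1) μ x - 1 with hHdef
  set Λ : ℕ → ℝ → ℝ := fun t θ => ν * ∑ i ∈ Finset.range t, H (renewalSeq α H θ i)
  have hrec : ∀ u ≤ c, (∀ k, renewalSeq α H (tiltParam μ (norm1 α) (ℓ 1 1) u) k ≤ c) ∧
      Tendsto (renewalSeq α H (tiltParam μ (norm1 α) (ℓ 1 1) u)) atTop (𝓝 u) := fun u hu =>
    renewalSeq_le_and_tendsto hα hsum h.tilt_pos.le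
      (fun v hv w hw hvw => sub_le_sub_right (h.mgf_monotoneOn hv hw hvw) 1)
      (h.mgf_continuousOn.sub continuousOn_const) (by simp [H]) h.tiltParam_strictMonoOn hu rfl
  have hS : ∀ t, Measurable (L Z ℓ t) := fun t =>
    Finset.measurable_sum _ fun s _ => hH.measurable_X s
  have hmom : ∀ θ ≤ tiltParam μ (norm1 α) (ℓ 1 1) c, ∀ t,
      Integrable (fun ω => Real.exp (θ * L Z ℓ t ω)) μ ∧
        ∫ ω, Real.exp (θ * L Z ℓ t ω) ∂μ = Real.exp (Λ t θ) := by
    intro θ hθ t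
    obtain ⟨u, hu, rfl⟩ := h.exists_tiltParam_eq hθ
    exact hH.integrable_exp_L_and_integral_eq hν hα
      (fun k => h.integrable_exp_of_le ((hrec u hu).1 k)) t
  have hlim : ∀ θ ≤ tiltParam μ (norm1 α) (ℓ 1 1) c,
      Tendsto (fun t : ℕ => (t : ℝ)⁻¹ * Λ t θ) atTop
        (𝓝 (GammaL μ ν (norm1 α) (ℓ 1 1) θ)) := by
    intro θ hθ
    obtain ⟨u, hu, rfl⟩ := h.exists_tiltParam_eq hθ
    have h1 : Tendsto (fun k => H (renewalSeq α H (tiltParam μ (norm1 α) (ℓ 1 1) u) k)) atTop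
        (𝓝 (H u)) :=
      ((h.mgf_continuousOn.sub continuousOn_const) u hu).tendsto.comp
        (tendsto_nhdsWithin_iff.2 ⟨(hrec u hu).2, Eventually.of_forall (hrec u hu).1⟩)
    rw [GammaL_tiltParam h hu]
    exact (h1.cesaro.const_mul ν).congr fun t => mul_left_comm _ _ _
  have hlow : ∀ {θ x : ℝ} {A : Set ℝ}, θ ≤ tiltParam μ (norm1 α) (ℓ 1 1) c →
      ExposedAt (GammaL μ ν (norm1 α) (ℓ 1 1)) (tiltParam μ (norm1 α) (ℓ 1 1) c) θ x →
      MeasurableSet A → x ∈ interior A →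
      ((-(θ * x - GammaL μ ν (norm1 α) (ℓ 1 1) θ) : ℝ) : EReal) ≤
        liminf (fun t : ℕ => (((t : ℝ)⁻¹ : ℝ) : EReal) *
          ENNReal.log (μ.map (fun ω => L Z ℓ t ω / (t : ℝ)) A)) atTop := fun hθ hx hA hxA =>
    le_liminf_log_of_exposedAt hS (fun θ hθ t => (hmom θ hθ t).1)
      (fun θ hθ t => (hmom θ hθ t).2) hlim hθ hx hA hxA
  refine ⟨rateL_nonneg h, rateL_lowerSemicontinuous _, fun n => Nat.cast_nonneg n,
    Nat.mono_cast, tendsto_natCast_atTop_atTop, fun A hA => ?_, fun A hA => ?_⟩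
  · rw [EReal.neg_le]
    refine le_iInf₂ fun x hx => ?_
    rcases lt_trichotomy x 0 with hx0 | rfl | hx0
    · rw [rateL_of_neg h hν hx0]
      exact le_top
    · -- At `0` the rate is the limit of the rates at small exposed points.
      obtain ⟨η, hη, hball⟩ := Metric.isOpen_iff.1 isOpen_interior 0 hx
      obtain ⟨θ, hθ, y, hy0, hyη, hy⟩ := exists_exposedAt_small h hν hη
      have hyA : y ∈ interior A := hball (by
        rw [Metric.mem_ball, Real.dist_eq, sub_zero, abs_of_pos hy0]
        exact hyη)
      have hθc := hθ.trans h.tiltParam_pos.le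
      have h1 := hlow hθc hy hA hyA
      rw [EReal.coe_neg] at h1
      refine (EReal.neg_le.1 h1).trans
        (le_trans ?_ (le_iSup₂_of_le θ (Set.mem_Iic.2 hθc) le_rfl))
      rw [EReal.coe_le_coe_iff]
      nlinarith
    · obtain ⟨u, hu, hux⟩ := h.exists_mgfDeriv_eq hν hx0
      have hθc := h.tiltParam_strictMonoOn.monotoneOn hu.le (Set.mem_Iic.2 le_rfl) hu.le
      have hex := h.exposedAt (fun v hv => GammaL_tiltParam h hv) hu hux
      have h1 := hlow hθc hex hA hx
      rw [EReal.coe_neg] at h1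
      exact (EReal.neg_le.1 h1).trans (le_iSup₂_of_le _ (Set.mem_Iic.2 hθc) le_rfl)
  · exact limsup_log_le_of_mgf h.tiltParam_pos hS (fun θ hθ t => (hmom θ hθ t).1)
      (fun θ hθ t => (hmom θ hθ t).2) hlim hA

end MarkedHawkes

theorem theorem2 {Ω : Type*} [MeasurableSpace Ω] (μ : Measure Ω) [IsProbabilityMeasure μ]
    (ν : ℝ) (hν : 0 < ν)
    (α : ℕ → ℝ) (hα : ∀ t, 1 ≤ t → 0 ≤ α t) (hα_sum : Summable fun t : ℕ => α (t + 1))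
    (hα_pos : 0 < MarkedHawkes.norm1 α)
    (Z : ℕ → Ω → ℕ) (ℓ : ℕ → ℕ → Ω → ℝ) (hH : MarkedHawkes.IsMarkedHawkes μ ν α Z ℓ)
    (hℓ : Integrable (ℓ 1 1) μ)
    (hsub : MarkedHawkes.norm1 α * ∫ ω, ℓ 1 1 ω ∂μ < 1) :
    ((∀ C : ℝ, ∃ u : ℝ, Integrable (fun ω => Real.exp (u * ℓ 1 1 ω)) μ ∧
        C ≤ ∫ ω, Real.exp (u * ℓ 1 1 ω) ∂μ) →
      ∃ θc xc : ℝ, MarkedHawkes.IsTangency μ (MarkedHawkes.norm1 α) (ℓ 1 1) θc xc) ∧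
    ∀ θc xc : ℝ, MarkedHawkes.IsTangency μ (MarkedHawkes.norm1 α) (ℓ 1 1) θc xc →
      0 < θc ∧
      (∀ θ' x' : ℝ, MarkedHawkes.IsTangency μ (MarkedHawkes.norm1 α) (ℓ 1 1) θ' x' →
        θ' = θc ∧ x' = xc) ∧
      (∀ θ ≤ θc, IsLeast (MarkedHawkes.solutions μ (MarkedHawkes.norm1 α) (ℓ 1 1) θ)
        (MarkedHawkes.gL μ (MarkedHawkes.norm1 α) (ℓ 1 1) θ)) ∧
      SatisfiesLDP
        (fun t : ℕ => μ.map (fun ω => MarkedHawkes.L Z ℓ t ω / (t : ℝ)))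
        (fun t : ℕ => (t : ℝ))
        (MarkedHawkes.rateL μ ν (MarkedHawkes.norm1 α) (ℓ 1 1) θc) := by
  set a := MarkedHawkes.norm1 α
  have hpos : ∀ᵐ ω ∂μ, 0 < ℓ 1 1 ω := hH.mark_pos 1 1 le_rfl le_rfl
  refine ⟨fun hunb => ?_, fun θc xc hT => ?_⟩
  · obtain ⟨c, hc⟩ := exists_isCriticalTilt hℓ hpos hα_pos hsub hunb
    exact ⟨_, _, MarkedHawkes.isTangency_of_isCriticalTilt hc⟩
  · have hc := hT.isCriticalTilt hℓ hpos hα_pos hsub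
    have hθc := hT.tiltParam_eq
    refine ⟨hθc ▸ hc.tiltParam_pos, fun θ' x' hT' => ?_, fun θ hθ => ?_, ?_⟩
    · have heq := hc.eq_of_isCriticalTilt (hT'.isCriticalTilt hℓ hpos hα_pos hsub)
      exact ⟨by rw [← hT'.tiltParam_eq, heq, hθc], by rw [← hT'.mgf_eq, heq, hT.mgf_eq]⟩
    · rw [← hθc] at hθ
      obtain ⟨u, hu, rfl⟩ := hc.exists_tiltParam_eq hθ
      have hleast := MarkedHawkes.isLeast_solutions hc hu
      rwa [MarkedHawkes.gL, hleast.csInf_eq]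
    · have hL := MarkedHawkes.satisfiesLDP_L hν hα hα_sum hH hc
      rwa [hθc] at hL
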